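/- Let $s\ge 2$, $m=2s$ and $1\le l\le m-1$ with $l\ne s$ be integers, and put $d=\gcd(s,l)$, $d'=\gcd(s+l,2l)$. Let $\mathbb{F}_{2^s}\subset\mathbb{F}_{2^m}$ be the finite fields with $2^s$ and $2^m$ elements, and let $\mathrm{Tr}_1^k:\mathbb{F}_{2^k}\to\mathbb{F}_2$ denote the absolute trace. Let $\mathcal{C}\subseteq\mathbb{F}_2^{2^m}$ be the binary linear code of length $2^m$ $$\mathcal{C}=\left\{\left(\mathrm{Tr}_1^s\left(ax^{2^s+1}\right)+\mathrm{Tr}_1^m\left(bx^{2^l+1}+cx\right)+h\right)_{x\in\mathbb{F}_{2^m}} : a\in\mathbb{F}_{2^s},\ b,c\in\mathbb{F}_{2^m},\ h\in\mathbb{F}_2\right\},$$ and let $A_i$ be the number of codewords of $\mathcal{C}$ of Hamming weight $i$. Then $\dim_{\mathbb{F}_2}\mathcal{C}=\frac{5m}{2}+1$, and the following holds. (1) If $d'=d$, then $$A_0=A_{2^{2s}}=1,$$ $$A_{2^{2s-1}-2^{s-1}}=A_{2^{2s-1}+2^{s-1}}=\frac{2^{2s}(2^s-1)\left(2^{2(s+d)}-2^{2s+d}-2^{2s}+2^{s+2d}-2^{s+d}+2^{2d}\right)}{2^{2d}-1},$$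 $$A_{2^{2s-1}-2^{s+d-1}}=A_{2^{2s-1}+2^{s+d-1}}=\frac{2^{2(s-d)}(2^{s+d}-1)(2^{2s}-1)}{2^{2d}-1},$$ $$A_{2^{2s-1}}=2\left(2^{3s-d}-2^{2(s-d)}+1\right)(2^{2s}-1),$$ and $A_i=0$ for every other $i$. Exactly six nonzero weights $i\geq 1$ occur. (2) If $d'=2d$, then $$A_0=A_{2^{2s}}=1,$$ $$A_{2^{2s-1}-2^{s-1}}=A_{2^{2s-1}+2^{s-1}}=\frac{2^{2s+3d}(2^s-1)\left(2^{2s}-2^{2(s-d)}-2^{2s-3d}+2^s-2^{s-d}+1\right)}{(2^{2d}-1)(2^d+1)},$$ $$A_{2^{2s-1}-2^{s+d-1}}=A_{2^{2s-1}+2^{s+d-1}}=\frac{2^{2s-d}(2^{2s}-1)\left(2^s+2^{s-d}+2^{s-2d}+1\right)}{(2^d+1)^2},$$ $$A_{2^{2s-1}-2^{s+2d-1}}=A_{2^{2s-1}+2^{s+2d-1}}=\frac{2^{2s-4d}(2^{s-d}-1)(2^{2s}-1)}{(2^d+1)(2^{2d}-1)},$$ $$A_{2^{2s-1}}=2(2^{2s}-1)\left(2^{3s-d}-2^{3s-2d}+2^{3s-3d}-2^{3s-4d}+2^{3s-5d}+2^{2s-d}-2^{2s-2d+1}+2^{2s-3d}-2^{2s-4d}+1\right),$$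 and $A_i=0$ for every other $i$. Exactly eight nonzero weights $i\geq 1$ occur. -/

import Mathlib

/-- Let `E` be the field with `2 ^ s` elements and `F` a quadratic extension of `E`. Every
`a * x ^ (2 ^ s + 1)` with `a ∈ E`, `x ∈ F` lies in `E`; this is what makes
`Tr_1^s (a * x ^ (2 ^ s + 1))` meaningful in the code below. -/
theorem existsUnique_relative_term {E F : Type*} [Field E] [Field F] [Fintype E] [Fintype F]
    [Algebra E F] {s : ℕ} (hE : Fintype.card E = 2 ^ s) (hF : Fintype.card F = 2 ^ (2 * s))
    (a : E) (x : F) :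
    ∃! y : E, algebraMap E F y = algebraMap E F a * x ^ (2 ^ s + 1) := by
  have hr : Module.finrank E F = 2 := by
    have h := Module.card_eq_pow_finrank (K := E) (V := F)
    rw [hE, hF] at h
    have h1 : 1 < 2 ^ s := by rw [← hE]; exact Fintype.one_lt_card
    rw [mul_comm 2 s, pow_mul] at h
    exact (Nat.pow_right_injective h1 h).symm
  have hn : algebraMap E F (Algebra.norm E x) = x ^ (2 ^ s + 1) := by
    rw [FiniteField.algebraMap_norm_eq_prod_pow, hr, Nat.card_eq_fintype_card, hE]
    simp [Finset.prod_range_succ, pow_succ, mul_comm]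
  refine ⟨a * Algebra.norm E x, by simp [hn], fun z hz => ?_⟩
  apply (algebraMap E F).injective
  rw [hz, map_mul, hn]

/-- The binary linear code, with coordinates indexed by the elements `x` of `F = F_{2^m}`
(so of length `2 ^ m`), consisting of all words
`(Tr_1^s (a x ^ (2 ^ s + 1)) + Tr_1^m (b x ^ (2 ^ l + 1) + c x) + h)_x`
with `a ∈ E = F_{2^s}`, `b, c ∈ F`, `h ∈ F_2`. The element `y` of `E` is the element
`a x ^ (2 ^ s + 1)` of `F`, seen in `E`. -/
def generalizedKasamiCode (E F : Type*) [Field E] [Field F] [Algebra (ZMod 2) E]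
    [Algebra (ZMod 2) F] [Algebra E F] (s l : ℕ) : Submodule (ZMod 2) (F → ZMod 2) where
  carrier := {w | ∃ (a : E) (b c : F) (h : ZMod 2), ∀ x : F, ∃ y : E,
    algebraMap E F y = algebraMap E F a * x ^ (2 ^ s + 1) ∧
    w x = Algebra.trace (ZMod 2) E y
      + Algebra.trace (ZMod 2) F (b * x ^ (2 ^ l + 1) + c * x) + h}
  zero_mem' := ⟨0, 0, 0, 0, fun x => ⟨0, by simp⟩⟩
  add_mem' := by
    rintro v w ⟨a, b, c, h, hv⟩ ⟨a', b', c', h', hw⟩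
    refine ⟨a + a', b + b', c + c', h + h', fun x => ?_⟩
    obtain ⟨y, hy, hvx⟩ := hv x
    obtain ⟨y', hy', hwx⟩ := hw x
    refine ⟨y + y', by rw [map_add, map_add, hy, hy', add_mul], ?_⟩
    simp only [Pi.add_apply, hvx, hwx, map_add, add_mul]
    ring
  smul_mem' := by
    rintro t w ⟨a, b, c, h, hw⟩
    have ht : t = 0 ∨ t = 1 := by
      revert t
      decide
    rcases ht with rfl | rfl
    · exact ⟨0, 0, 0, 0, fun x => ⟨0, by simp⟩⟩
    · rw [one_smul]
      exact ⟨a, b, c, h, hw⟩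

/-- The number `A_i` of codewords of Hamming weight `i` in the binary code `C`. -/
noncomputable def weightCount {ι : Type*} [Fintype ι] (C : Submodule (ZMod 2) (ι → ZMod 2))
    (i : ℕ) : ℕ :=
  Set.ncard {w : ι → ZMod 2 | w ∈ C ∧ hammingNorm w = i}

/-- The weight distribution claimed for `d' = d`: the number of codewords of weight `i`.
All differences of exponents and of weights are nonnegative, since then `d < s`. -/
def weightTableEq (s d i : ℕ) : ℚ :=
  if i = 0 then 1
  else if i = 2 ^ (2 * s - 1) - 2 ^ (s - 1) ∨ i = 2 ^ (2 * s - 1) + 2 ^ (s - 1) then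
    2 ^ (2 * s) * (2 ^ s - 1) *
      (2 ^ (2 * (s + d)) - 2 ^ (2 * s + d) - 2 ^ (2 * s) + 2 ^ (s + 2 * d) - 2 ^ (s + d)
        + 2 ^ (2 * d)) / (2 ^ (2 * d) - 1)
  else if i = 2 ^ (2 * s - 1) - 2 ^ (s + d - 1) ∨ i = 2 ^ (2 * s - 1) + 2 ^ (s + d - 1) then
    2 ^ (2 * (s - d)) * (2 ^ (s + d) - 1) * (2 ^ (2 * s) - 1) / (2 ^ (2 * d) - 1)
  else if i = 2 ^ (2 * s - 1) then
    2 * (2 ^ (3 * s - d) - 2 ^ (2 * (s - d)) + 1) * (2 ^ (2 * s) - 1)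
  else if i = 2 ^ (2 * s) then 1
  else 0

/-- The weight distribution claimed for `d' = 2 * d`: the number of codewords of weight `i`.
All differences of exponents and of weights are nonnegative, since then `3 * d ≤ s`. -/
def weightTableTwo (s d i : ℕ) : ℚ :=
  if i = 0 then 1
  else if i = 2 ^ (2 * s - 1) - 2 ^ (s - 1) ∨ i = 2 ^ (2 * s - 1) + 2 ^ (s - 1) then
    2 ^ (2 * s + 3 * d) * (2 ^ s - 1) *
      (2 ^ (2 * s) - 2 ^ (2 * (s - d)) - 2 ^ (2 * s - 3 * d) + 2 ^ s - 2 ^ (s - d) + 1)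
      / ((2 ^ (2 * d) - 1) * (2 ^ d + 1))
  else if i = 2 ^ (2 * s - 1) - 2 ^ (s + d - 1) ∨ i = 2 ^ (2 * s - 1) + 2 ^ (s + d - 1) then
    2 ^ (2 * s - d) * (2 ^ (2 * s) - 1) * (2 ^ s + 2 ^ (s - d) + 2 ^ (s - 2 * d) + 1)
      / (2 ^ d + 1) ^ 2
  else if i = 2 ^ (2 * s - 1) then
    2 * (2 ^ (2 * s) - 1) *
      (2 ^ (3 * s - d) - 2 ^ (3 * s - 2 * d) + 2 ^ (3 * s - 3 * d) - 2 ^ (3 * s - 4 * d)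
        + 2 ^ (3 * s - 5 * d) + 2 ^ (2 * s - d) - 2 ^ (2 * s - 2 * d + 1)
        + 2 ^ (2 * s - 3 * d) - 2 ^ (2 * s - 4 * d) + 1)
  else if i = 2 ^ (2 * s - 1) - 2 ^ (s + 2 * d - 1) ∨
      i = 2 ^ (2 * s - 1) + 2 ^ (s + 2 * d - 1) then
    2 ^ (2 * s - 4 * d) * (2 ^ (s - d) - 1) * (2 ^ (2 * s) - 1)
      / ((2 ^ d + 1) * (2 ^ (2 * d) - 1))
  else if i = 2 ^ (2 * s) then 1
  else 0

/-! A codeword is a quadratic form `Q(x) = Tr_E (a N(x)) + Tr_F (b x ^ (2 ^ l + 1))` plus an affine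
function, and `2 ^ (2 s)` minus twice its weight is the exponential sum of the word. Squaring that
sum shows that it is zero or has square `2 ^ (2 s)` times the size of the radical of `Q`
(`expSum_sq_eq_zero_or`). By Parseval, the number of linear twists `c` giving a nonzero sum depends
only on that size (`card_expSum_ne_zero_mul`), and the constant `h` makes both signs equally
frequent. Hence the weight distribution is determined by the number of pairs `(a, b)` with each
radical size.

The radical is the zero set of a polynomial of degree at most two in `τ = Frob ^ (s + l)`, whose
fixed field has `2 ^ d'` elements, since `d' = gcd(2 s, s + l)`. So for `(a, b) ≠ 0` its size is `2
^ (d' k)` with `k ≤ 2` (`exists_card_ker_kasamiPolar`). As `d' < s`, the radical is never all of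
`F`; this yields injectivity of the parametrisation and the dimension. If `d' = d`, the form lifts
to an alternating form over the field with `2 ^ d` elements, and `k` must be even
(`even_of_card_ker_kasamiPolar`). The sizes are therefore `1, 2 ^ (2 d)` if `d' = d`, and `1, 2 ^ (2
d), 2 ^ (4 d)` if `d' = 2 d`.

The multiplicities solve a linear system. One equation is the number of pairs; another is the sum of
all radical sizes, by double counting (`sum_natCard_ker_kasamiPolar`). For `d' = 2 d` a third is
needed: the sum of all untwisted exponential sums, whose signs are forced by a congruence modulo `2
^ d + 1` (`expSum_kasamiForm_eq`). -/

/-- The sign character `t ↦ (-1) ^ t` of `ZMod 2`. -/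
def signChar (t : ZMod 2) : ℤ := if t = 0 then 1 else -1

@[simp] theorem signChar_zero : signChar 0 = 1 := rfl

theorem signChar_add (s t : ZMod 2) : signChar (s + t) = signChar s * signChar t := by
  revert s t; decide

theorem signChar_mul_self (t : ZMod 2) : signChar t * signChar t = 1 := by
  revert t; decide

theorem signChar_one : signChar 1 = -1 := rfl

theorem zmod_two_eq_one_of_ne_zero {t : ZMod 2} (h : t ≠ 0) : t = 1 := by
  revert t; decide

/-! ### Exponential sums of quadratic functions over F_2. -/

section QuadraticSum

variable {V : Type*} [AddCommGroup V]

variable {f : V → ZMod 2} {B : V →+ V →+ ZMod 2}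

theorem polar_zero (hf : ∀ x y, f (x + y) = f x + f y + B x y) : f 0 = 0 := by
  have := hf 0 0
  simpa using this

/-- A linear twist does not change the polarisation, so every result about `f` applies to all its
twists with the same radical. -/
theorem polar_add_linear (hf : ∀ x y, f (x + y) = f x + f y + B x y) (φ : V →+ ZMod 2) (x y : V) :
    f (x + y) + φ (x + y) = f x + φ x + (f y + φ y) + B x y := by
  rw [hf, map_add]; ring

variable [Fintype V]

theorem sum_signChar_of_ne_zero (φ : V →+ ZMod 2) (h : φ ≠ 0) : ∑ x, signChar (φ x) = 0 := by
  obtain ⟨x₀, hx₀⟩ : ∃ x₀, φ x₀ ≠ 0 := by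
    by_contra! h'
    exact h (AddMonoidHom.ext h')
  have h1 : ∑ x, signChar (φ x) = ∑ x, signChar (φ (x + x₀)) :=
    (Equiv.sum_comp (Equiv.addRight x₀) fun x => signChar (φ x)).symm
  simp only [map_add, signChar_add, zmod_two_eq_one_of_ne_zero hx₀, signChar_one,
    mul_neg_one, Finset.sum_neg_distrib] at h1
  lia

theorem sum_signChar_zero : ∑ x : V, signChar ((0 : V →+ ZMod 2) x) = Fintype.card V := by
  simp

/-- The exponential sum of a function with values in `ZMod 2`. -/
def expSum (f : V → ZMod 2) : ℤ := ∑ x, signChar (f x)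

open scoped Classical in
-- Pair `x` with `y + x`: since `f x + f (y + x) = f y + B y x`, the sum over `x` is a character sum
-- of `B y`, which vanishes unless `y` lies in the radical.
theorem expSum_sq (hf : ∀ x y, f (x + y) = f x + f y + B x y) :
    expSum f ^ 2 = Fintype.card V * ∑ y, if B y = 0 then signChar (f y) else 0 := by
  have h1 : expSum f ^ 2 = ∑ y, ∑ x, signChar (f x) * signChar (f (y + x)) := by
    rw [sq, expSum, Finset.sum_mul_sum]
    refine Eq.trans ?_ Finset.sum_comm
    exact Finset.sum_congr rfl fun x _ =>
      (Equiv.sum_comp (Equiv.addRight x) fun y => signChar (f x) * signChar (f y)).symm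
  rw [h1, Finset.mul_sum]
  refine Finset.sum_congr rfl fun y _ => ?_
  have h2 : ∀ x, signChar (f x) * signChar (f (y + x)) = signChar (f y) * signChar (B y x) := by
    intro x
    rw [hf, signChar_add, signChar_add]
    linear_combination signChar (f y) * signChar (B y x) * signChar_mul_self (f x)
  simp only [h2, ← Finset.mul_sum]
  split_ifs with h
  · rw [h, sum_signChar_zero, mul_comm]
  · rw [sum_signChar_of_ne_zero _ h]; simp

/-- On the radical `f` is additive, so what remains is again a character sum. -/
theorem expSum_sq_eq_zero_or (hf : ∀ x y, f (x + y) = f x + f y + B x y) :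
    expSum f ^ 2 = 0 ∨ expSum f ^ 2 = Fintype.card V * Nat.card B.ker := by
  classical
  have hres : ∀ y : B.ker, ∀ z : B.ker, f (y + z) = f y + f z := by
    rintro ⟨y, hy⟩ ⟨z, hz⟩
    have : B y = 0 := hy
    simp [hf, this]
  let φ : B.ker →+ ZMod 2 :=
    { toFun := fun y => f y
      map_zero' := polar_zero hf
      map_add' := fun y z => hres y z }
  have h1 : (∑ y, if B y = 0 then signChar (f y) else 0) = ∑ y : B.ker, signChar (φ y) := by
    rw [← Finset.sum_filter]
    exact Finset.sum_subtype _ (by simp [AddMonoidHom.mem_ker]) _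
  rw [expSum_sq hf, h1]
  by_cases h : φ = 0
  · right
    rw [h, sum_signChar_zero, Nat.card_eq_fintype_card]
  · left
    rw [sum_signChar_of_ne_zero _ h, mul_zero]

variable {P : V →+ V →+ ZMod 2}

/-- Parseval: nondegeneracy of the pairing kills every `y ≠ 0` once the sum over `c` is taken
inside. -/
theorem sum_expSum_sq (hf : ∀ x y, f (x + y) = f x + f y + B x y)
    (hP : ∀ y, (∀ c, P c y = 0) → y = 0) :
    ∑ c, expSum (fun x => f x + P c x) ^ 2 = (Fintype.card V : ℤ) ^ 2 := by
  classical
  have h1 : ∀ c, expSum (fun x => f x + P c x) ^ 2 =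
      Fintype.card V * ∑ y, if B y = 0 then signChar (f y) * signChar (P.flip y c) else 0 := by
    intro c
    rw [expSum_sq (B := B) (polar_add_linear hf (P c))]
    simp [signChar_add]
  simp only [h1, ← Finset.mul_sum]
  rw [Finset.sum_comm, sq, Finset.sum_eq_single 0]
  · simp [polar_zero hf]
  · intro y _ hy
    split_ifs with h
    · rw [← Finset.mul_sum, sum_signChar_of_ne_zero, mul_zero]
      intro h0
      exact hy (hP y fun c => DFunLike.congr_fun h0 c)
    · simp
  · simp

/-- Each squared sum takes one of two values, one of them zero, so the second moment fixes how often
the other occurs. -/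
theorem card_expSum_ne_zero_mul (hf : ∀ x y, f (x + y) = f x + f y + B x y)
    (hP : ∀ y, (∀ c, P c y = 0) → y = 0) :
    Nat.card {c // expSum (fun x => f x + P c x) ^ 2 = Fintype.card V * Nat.card B.ker}
      * Nat.card B.ker = Fintype.card V := by
  classical
  have h := sum_expSum_sq hf hP
  have h1 : ∀ c, expSum (fun x => f x + P c x) ^ 2 =
      if expSum (fun x => f x + P c x) ^ 2 = Fintype.card V * Nat.card B.ker then
        (Fintype.card V * Nat.card B.ker : ℤ) else 0 := by
    intro c
    split_ifs with h2
    · exact h2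
    · exact (expSum_sq_eq_zero_or (B := B) (polar_add_linear hf (P c))).resolve_right h2
  rw [Finset.sum_congr rfl fun c _ => h1 c, ← Finset.sum_filter, Finset.sum_const,
    ← Fintype.card_subtype, ← Nat.card_eq_fintype_card, nsmul_eq_mul] at h
  have hV : (Fintype.card V : ℤ) ≠ 0 := by exact_mod_cast Fintype.card_ne_zero
  have h3 : (Fintype.card V : ℤ) * (Nat.card {c // expSum (fun x => f x + P c x) ^ 2 =
      Fintype.card V * Nat.card B.ker} * Nat.card B.ker) = Fintype.card V * Fintype.card V := by
    rw [← sq, ← h]; ring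
  exact_mod_cast mul_left_cancel₀ hV h3

end QuadraticSum

/-! ### Powers of Frobenius and their fixed fields. -/

section FrobeniusPowers

variable {F : Type*} [Field F] [Algebra (ZMod 2) F]

theorem add_self_of_algebra_zmod_two (x : F) : x + x = 0 := by
  have : CharP F 2 := charP_of_injective_algebraMap (algebraMap (ZMod 2) F).injective 2
  exact CharTwo.add_self_eq_zero x

variable [Fintype F]

/-- The automorphism `x ↦ x ^ (2 ^ k)` of a finite field of characteristic `2`. -/
noncomputable def frobPow (F : Type*) [Field F] [Fintype F] [Algebra (ZMod 2) F] (k : ℕ) :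
    F ≃ₐ[ZMod 2] F :=
  FiniteField.frobeniusAlgEquivOfAlgebraic (ZMod 2) F ^ k

theorem frobPow_apply (k : ℕ) (x : F) : frobPow F k x = x ^ 2 ^ k := by
  rw [frobPow, AlgEquiv.coe_pow, FiniteField.coe_frobeniusAlgEquivOfAlgebraic_iterate, ZMod.card]

theorem frobPow_add_apply (j k : ℕ) (x : F) :
    frobPow F (j + k) x = frobPow F j (frobPow F k x) := by
  rw [frobPow, pow_add]; rfl

theorem frobPow_comm (j k : ℕ) (x : F) :
    frobPow F j (frobPow F k x) = frobPow F k (frobPow F j x) := by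
  rw [← frobPow_add_apply, add_comm, frobPow_add_apply]

theorem frobPow_card {m : ℕ} (hF : Fintype.card F = 2 ^ m) (x : F) : frobPow F m x = x := by
  rw [frobPow_apply, ← hF, FiniteField.pow_card]

theorem trace_frobPow (k : ℕ) (x : F) :
    Algebra.trace (ZMod 2) F (frobPow F k x) = Algebra.trace (ZMod 2) F x :=
  Algebra.trace_eq_of_algEquiv (frobPow F k) x

theorem card_units_pow_eq_one (F : Type*) [Field F] [Fintype F] (n : ℕ) :
    Nat.card {u : Fˣ // u ^ n = 1} = (Fintype.card F - 1).gcd n := by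
  have h := IsCyclic.card_powMonoidHom_ker Fˣ n
  rw [Nat.card_units, Nat.card_eq_fintype_card (α := F)] at h
  exact h

theorem frobPow_eq_self_of_dvd {j k : ℕ} {x : F} (hj : frobPow F j x = x) (h : j ∣ k) :
    frobPow F k x = x := by
  have key : ∀ n : ℕ, frobPow F n x = x ↔ Function.IsPeriodicPt (fun y : F => y ^ 2) n x := by
    intro n
    rw [frobPow_apply, Function.IsPeriodicPt, Function.IsFixedPt, pow_iterate]
  rw [key] at *
  exact hj.trans_dvd h

/-- The nonzero fixed points are the roots of unity of order dividing `2 ^ k - 1`, and `gcd(2 ^ m -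
1, 2 ^ k - 1) = 2 ^ gcd(m, k) - 1`. -/
theorem card_frobPow_fixed {m : ℕ} (hF : Fintype.card F = 2 ^ m) (k : ℕ) :
    Nat.card {x : F // frobPow F k x = x} = 2 ^ m.gcd k := by
  classical
  have h1 := card_units_pow_eq_one F (2 ^ k - 1)
  rw [hF, Nat.pow_sub_one_gcd_pow_sub_one] at h1
  have hk : 2 ^ k = 2 ^ k - 1 + 1 := (Nat.sub_add_cancel Nat.one_le_two_pow).symm
  have h2 : (Finset.univ.filter fun x : F => frobPow F k x = x) =
      insert 0 ((Finset.univ.filter fun u : Fˣ => u ^ (2 ^ k - 1) = 1).map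
        ⟨Units.val, Units.val_injective⟩) := by
    ext x
    simp only [Finset.mem_filter, Finset.mem_univ, true_and, Finset.mem_insert, Finset.mem_map,
      Function.Embedding.coeFn_mk]
    constructor
    · intro hx
      by_cases h0 : x = 0
      · exact Or.inl h0
      · refine Or.inr ⟨Units.mk0 x h0, ?_, rfl⟩
        ext
        rw [frobPow_apply, hk, pow_succ] at hx
        simpa using mul_right_cancel₀ h0 (hx.trans (one_mul x).symm)
    · rintro (rfl | ⟨u, hu, rfl⟩)
      · simp
      · rw [frobPow_apply, hk, pow_succ, ← Units.val_pow_eq_pow_val, hu]; simp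
  rw [Nat.card_eq_fintype_card, Fintype.card_subtype, h2, Finset.card_insert_of_notMem (by simp),
    Finset.card_map, ← Fintype.card_subtype, ← Nat.card_eq_fintype_card, h1]
  exact Nat.sub_add_cancel Nat.one_le_two_pow

end FrobeniusPowers

/-! ### Roots of polynomials in a field automorphism. -/

section TwistedPolynomial

variable {F : Type*} [Field F] [Fintype F]

/-- The quotient of any solution by a fixed nonzero one is invariant under `τ`. -/
theorem card_semilinear_eq_le (τ : F ≃+* F) {A C : F} (h : ¬ (A = 0 ∧ C = 0)) :
    Nat.card {w : F // A * τ w = C * w} ≤ Nat.card {x : F // τ x = x} := by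
  by_cases hw : ∃ w : F, w ≠ 0 ∧ A * τ w = C * w
  · obtain ⟨w₀, h0, hw₀⟩ := hw
    have hτ : τ w₀ ≠ 0 := by simpa using h0
    have hA : A ≠ 0 := by
      rintro rfl
      simp only [zero_mul, zero_eq_mul, h0, or_false] at hw₀
      exact h ⟨rfl, hw₀⟩
    refine Nat.card_le_card_of_injective
      (fun w => ⟨w.1 / w₀, ?_⟩ : {w : F // A * τ w = C * w} → {x : F // τ x = x}) ?_
    · rw [map_div₀, div_eq_div_iff hτ h0]
      apply mul_left_cancel₀ hA
      linear_combination w₀ * w.2 - w.1 * hw₀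
    · intro w w' hww
      simp only [Subtype.mk.injEq] at hww
      exact Subtype.ext ((div_left_inj' h0).1 hww)
  · push Not at hw
    have : Subsingleton {w : F // A * τ w = C * w} :=
      ⟨fun w w' => Subtype.ext <| by
        have h1 := not_imp_comm.1 (hw w.1) (not_not.2 w.2)
        have h2 := not_imp_comm.1 (hw w'.1) (not_not.2 w'.2)
        rw [h1, h2]⟩
    have : Nonempty {x : F // τ x = x} := ⟨⟨0, map_zero τ⟩⟩
    exact (Finite.card_le_one_iff_subsingleton.2 inferInstance).trans Nat.card_pos

/-- A nonzero twisted polynomial of degree at most two has at most `|Fix τ| ^ 2` roots. -/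
theorem card_twisted_quadratic_le (τ : F ≃+* F) {A B C : F} (h : ¬ (A = 0 ∧ B = 0 ∧ C = 0)) :
    Nat.card {x : F // A * τ (τ x) + B * τ x + C * x = 0} ≤
      Nat.card {x : F // τ x = x} ^ 2 := by
  classical
  by_cases hx : ∃ x₀ : F, x₀ ≠ 0 ∧ A * τ (τ x₀) + B * τ x₀ + C * x₀ = 0
  · obtain ⟨x₀, h0, hx₀⟩ := hx
    have h1 : τ x₀ ≠ 0 := by simpa using h0
    have h2 : τ (τ x₀) ≠ 0 := by simpa using h0
    set A' := A * τ (τ x₀) with hA'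
    set C' := C * x₀ with hC'
    have hAC : ¬ (A' = 0 ∧ C' = 0) := by
      rintro ⟨hA, hC⟩
      rw [hA, hC] at hx₀
      simp only [zero_add, add_zero, mul_eq_zero, h1, or_false] at hx₀
      simp only [hA', hC', mul_eq_zero, h0, h2, or_false] at hA hC
      exact h ⟨hA, hx₀, hC⟩
    have hW := card_semilinear_eq_le τ hAC
    simp only [Nat.card_eq_fintype_card, Fintype.card_subtype] at hW ⊢
    -- Reduction of order: with `x = x₀ z` the coefficients sum to zero, so the equation reads `A'
    -- (τ (τ z) - τ z) = C' (τ z - z)`, which is first order in `w = τ z - z`.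
    let g : F → F := fun x => τ (x / x₀) - x / x₀
    have himg : (Finset.univ.filter fun x : F => A * τ (τ x) + B * τ x + C * x = 0).image g ⊆
        Finset.univ.filter fun w : F => A' * τ w = C' * w := by
      intro w hw
      simp only [Finset.mem_image, Finset.mem_filter, Finset.mem_univ, true_and, g] at hw ⊢
      obtain ⟨x, hx, rfl⟩ := hw
      have hx' : x = x₀ * (x / x₀) := by field_simp
      generalize x / x₀ = z at hx'
      subst hx'
      simp only [map_mul, map_sub] at hx ⊢
      linear_combination hx - τ z * hx₀
    have hfib : ∀ w ∈ (Finset.univ.filter fun x : F => A * τ (τ x) + B * τ x + C * x = 0).image g,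
        (Finset.filter (fun x => g x = w)
          (Finset.univ.filter fun x : F => A * τ (τ x) + B * τ x + C * x = 0)).card ≤
        (Finset.univ.filter fun x : F => τ x = x).card := by
      intro w hw
      obtain ⟨x₁, -, hx₁⟩ := Finset.mem_image.1 hw
      -- Two points of a fibre of `g` differ, after division by `x₀`, by an element fixed by `τ`.
      refine Finset.card_le_card_of_injOn (fun x => x / x₀ - x₁ / x₀) ?_ ?_
      · intro x hx
        simp only [Finset.coe_filter, Finset.mem_filter, Finset.mem_univ, true_and,
          Set.mem_ofPred_eq, g, map_sub] at hx hx₁ ⊢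
        linear_combination hx.2 - hx₁
      · intro x _ x' _ hxx
        simp only [sub_left_inj] at hxx
        exact (div_left_inj' h0).1 hxx
    calc _ ≤ _ := Finset.card_le_mul_card_image _ _ hfib
      _ ≤ _ := by
        rw [sq]
        exact Nat.mul_le_mul_left _ ((Finset.card_le_card himg).trans hW)
  · push Not at hx
    have : Subsingleton {x : F // A * τ (τ x) + B * τ x + C * x = 0} :=
      ⟨fun w w' => Subtype.ext <| by
        have h1 := not_imp_comm.1 (hx w.1) (not_not.2 w.2)
        have h2 := not_imp_comm.1 (hx w'.1) (not_not.2 w'.2)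
        rw [h1, h2]⟩
    have : Nonempty {x : F // τ x = x} := ⟨⟨0, map_zero τ⟩⟩
    exact (Finite.card_le_one_iff_subsingleton.2 inferInstance).trans
      (Nat.one_le_pow _ _ Nat.card_pos)

/-- The roots form a vector space over the fixed field of `τ`; the bound on their number bounds its
dimension. -/
theorem card_twisted_quadratic_eq_pow (τ : F ≃+* F) {A B C : F}
    (h : ¬ (A = 0 ∧ B = 0 ∧ C = 0)) :
    ∃ k ≤ 2, Nat.card {x : F // A * τ (τ x) + B * τ x + C * x = 0} =
      Nat.card {x : F // τ x = x} ^ k := by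
  classical
  let K : Subfield F := (τ : F →+* F).eqLocusField (RingHom.id F)
  have hK : ∀ x : K, τ x = x := fun x => x.2
  let R : Submodule K F :=
    { carrier := {x | A * τ (τ x) + B * τ x + C * x = 0}
      zero_mem' := by simp
      add_mem' := by
        intro x y hx hy
        simp only [Set.mem_ofPred_eq, map_add] at *
        linear_combination hx + hy
      smul_mem' := by
        intro c x hx
        simp only [Set.mem_ofPred_eq, Subfield.smul_def, smul_eq_mul, map_mul, hK] at *
        linear_combination (c : F) * hx }
  have hR : Nat.card {x : F // A * τ (τ x) + B * τ x + C * x = 0} =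
      Nat.card {x : F // τ x = x} ^ Module.finrank K R :=
    Module.natCard_eq_pow_finrank (K := K) (V := R)
  refine ⟨Module.finrank K R, ?_, hR⟩
  have hle := card_twisted_quadratic_le τ h
  rw [hR] at hle
  have h1 : 1 < Nat.card {x : F // τ x = x} := by
    have : Nontrivial {x : F // τ x = x} :=
      ⟨⟨0, map_zero τ⟩, ⟨1, map_one τ⟩, fun h => zero_ne_one (congrArg Subtype.val h)⟩
    exact Finite.one_lt_card
  exact (Nat.pow_le_pow_iff_right h1).1 hle

end TwistedPolynomial

/-! ### Parity of the rank of an alternating form. -/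

section Alternating

/-- The rank of an alternating bilinear form is even. -/
theorem even_finrank_add_finrank_ker_of_isAlt {K V : Type*} [Field K] [AddCommGroup V] [Module K V]
    [FiniteDimensional K V] (B : LinearMap.BilinForm K V) (hB : B.IsAlt) :
    Even (Module.finrank K V + Module.finrank K (LinearMap.ker B)) := by
  -- A maximal totally isotropic `W` equals its orthogonal, because adjoining an orthogonal vector
  -- keeps it isotropic when `B x x = 0`. It then contains the radical, and the dimension formula
  -- reads `2 dim W = dim V + dim ker B`.
  obtain ⟨W, hW, hmax⟩ := (wellFounded_gt (α := Submodule K V)).has_min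
    {W : Submodule K V | W ≤ B.orthogonal W} ⟨⊥, bot_le (a := B.orthogonal ⊥)⟩
  have hW' : ∀ x ∈ W, ∀ y ∈ W, B x y = 0 := fun x hx y hy => hW hy x hx
  have hle : B.orthogonal W ≤ W := by
    intro x hx
    have hxo : ∀ w ∈ W, B w x = 0 := fun w hw => hx w hw
    have hiso : W ⊔ Submodule.span K {x} ≤ B.orthogonal (W ⊔ Submodule.span K {x}) := by
      intro y hy z hz
      obtain ⟨w, hw, y', hy', rfl⟩ := Submodule.mem_sup.1 hy
      obtain ⟨w', hw', z', hz', rfl⟩ := Submodule.mem_sup.1 hz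
      obtain ⟨c, rfl⟩ := Submodule.mem_span_singleton.1 hy'
      obtain ⟨c', rfl⟩ := Submodule.mem_span_singleton.1 hz'
      have h1 : B x w = 0 := hB.isRefl.eq_zero (hxo w hw)
      have h2 : B x x = 0 := hB.self_eq_zero x
      simp [hW' w' hw' w hw, hxo w' hw', h1, h2]
    have h := eq_of_le_of_not_lt (le_sup_left : W ≤ W ⊔ Submodule.span K {x}) (hmax _ hiso)
    rw [h]
    exact Submodule.mem_sup_right (Submodule.mem_span_singleton_self x)
  have hker : LinearMap.ker B ≤ W := by
    refine le_trans (fun x hx => ?_) hle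
    intro w _
    have hx0 : B x = 0 := hx
    exact hB.isRefl.eq_zero (by rw [hx0]; rfl)
  have h := LinearMap.BilinForm.finrank_add_finrank_orthogonal' (B := B) W
  rw [le_antisymm hle hW, inf_eq_right.2 hker] at h
  exact ⟨_, h.symm⟩

end Alternating

/-! ### The quadratic form of a codeword and its radical. -/

section KasamiForm

variable {E F : Type*} [Field E] [Field F] [Fintype E] [Fintype F]
    [Algebra (ZMod 2) E] [Algebra (ZMod 2) F] [Algebra E F]

variable (F) in
/-- The pairing `(x, y) ↦ Tr (x y)`. -/
noncomputable def traceMul : F →+ F →+ ZMod 2 :=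
  (AddMonoidHom.compHom (Algebra.trace (ZMod 2) F).toAddMonoidHom).comp AddMonoidHom.mul

omit [Fintype F] in
theorem traceMul_apply (x y : F) : traceMul F x y = Algebra.trace (ZMod 2) F (x * y) := rfl

theorem eq_zero_of_traceMul_eq_zero {x : F} (h : ∀ y, traceMul F x y = 0) : x = 0 :=
  (traceForm_nondegenerate (ZMod 2) F).1 x h

theorem eq_zero_of_traceMul_eq_zero' {x : F} (h : ∀ y, traceMul F y x = 0) : x = 0 :=
  (traceForm_nondegenerate (ZMod 2) F).2 x h

/-- The function `x ↦ Tr_E (a N(x)) + Tr_F (b x ^ (2 ^ l + 1))`. -/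
noncomputable def kasamiForm (l : ℕ) (a : E) (b x : F) : ZMod 2 :=
  Algebra.trace (ZMod 2) E (a * Algebra.norm E x) +
    Algebra.trace (ZMod 2) F (b * x ^ (2 ^ l + 1))

/-- The linear map representing the polarisation of `kasamiForm` with respect to the trace
pairing. -/
noncomputable def polarMap (s l : ℕ) (a : E) (b : F) : F →+ F where
  toFun x := algebraMap E F a * frobPow F s x + b * frobPow F l x + (frobPow F l).symm (b * x)
  map_zero' := by simp
  map_add' x y := by simp only [map_add, mul_add]; ring

omit [Fintype E] [Algebra (ZMod 2) E] in
theorem polarMap_apply (s l : ℕ) (a : E) (b x : F) : polarMap s l a b x =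
    algebraMap E F a * frobPow F s x + b * frobPow F l x + (frobPow F l).symm (b * x) := rfl

/-- The polarisation of `kasamiForm`. -/
noncomputable def kasamiPolar (s l : ℕ) (a : E) (b : F) : F →+ F →+ ZMod 2 :=
  (traceMul F).comp (polarMap s l a b)

omit [Fintype E] [Algebra (ZMod 2) E] in
theorem kasamiPolar_apply (s l : ℕ) (a : E) (b x y : F) :
    kasamiPolar s l a b x y = Algebra.trace (ZMod 2) F (polarMap s l a b x * y) := rfl

variable {s : ℕ} (hE : Fintype.card E = 2 ^ s) (hF : Fintype.card F = 2 ^ (2 * s))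

include hE hF

omit [Algebra (ZMod 2) E] [Algebra (ZMod 2) F] in
theorem finrank_eq_two_of_card : Module.finrank E F = 2 := by
  have h := Module.card_eq_pow_finrank (K := E) (V := F)
  rw [hE, hF] at h
  have h1 : 1 < 2 ^ s := by rw [← hE]; exact Fintype.one_lt_card
  rw [mul_comm 2 s, pow_mul] at h
  exact (Nat.pow_right_injective h1 h).symm

omit [Algebra (ZMod 2) E] in
theorem algebraMap_norm_eq (x : F) :
    algebraMap E F (Algebra.norm E x) = x * frobPow F s x := by
  rw [FiniteField.algebraMap_norm_eq_prod_pow, finrank_eq_two_of_card hE hF,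
    Nat.card_eq_fintype_card, hE, frobPow_apply]
  simp [Finset.prod_range_succ]

omit [Algebra (ZMod 2) E] in
theorem algebraMap_trace_eq (x : F) :
    algebraMap E F (Algebra.trace E F x) = x + frobPow F s x := by
  rw [FiniteField.algebraMap_trace_eq_sum_pow, finrank_eq_two_of_card hE hF,
    Nat.card_eq_fintype_card, hE, frobPow_apply]
  simp [Finset.sum_range_succ]

omit [Field E] [Fintype E] [Algebra (ZMod 2) E] [Algebra E F] hE in
theorem frobPow_frobPow_half (x : F) : frobPow F s (frobPow F s x) = x := by
  rw [← frobPow_add_apply, ← two_mul, frobPow_card hF]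

omit [Fintype F] hF [Algebra (ZMod 2) F] in
omit [Algebra (ZMod 2) E] in
theorem algebraMap_pow_half (a : E) :
    algebraMap E F a ^ 2 ^ s = algebraMap E F a := by
  rw [← map_pow, ← hE, FiniteField.pow_card]

omit hE hF in
theorem trace_mul_trace (a : E) (z : F) :
    Algebra.trace (ZMod 2) E (a * Algebra.trace E F z) =
      Algebra.trace (ZMod 2) F (algebraMap E F a * z) := by
  have : IsScalarTower (ZMod 2) E F := IsScalarTower.of_algebraMap_eq' (Subsingleton.elim _ _)
  rw [← Algebra.trace_trace (S := E) (algebraMap E F a * z), ← Algebra.smul_def, map_smul,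
    smul_eq_mul]

/-- The norm of the quadratic extension polarises to a trace, and the cross term `b x y ^ (2 ^ l)`
is brought into the form `(...) y` because the trace is Frobenius invariant. -/
theorem kasamiForm_add (l : ℕ) (a : E) (b x y : F) :
    kasamiForm l a b (x + y) = kasamiForm l a b x + kasamiForm l a b y +
      kasamiPolar s l a b x y := by
  have hN : Algebra.norm E (x + y) = Algebra.norm E x + Algebra.norm E y +
      Algebra.trace E F (frobPow F s x * y) := by
    apply (algebraMap E F).injective
    simp only [map_add, algebraMap_norm_eq hE hF, algebraMap_trace_eq hE hF, map_mul,
      frobPow_frobPow_half hF]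
    ring
  have hS : Algebra.trace (ZMod 2) F ((frobPow F l).symm (b * x) * y) =
      Algebra.trace (ZMod 2) F (b * x * frobPow F l y) := by
    rw [← trace_frobPow l, map_mul, AlgEquiv.apply_symm_apply]
  rw [kasamiPolar_apply, polarMap_apply, add_mul, add_mul, map_add, map_add, hS,
    kasamiForm, kasamiForm, kasamiForm, hN, mul_add, mul_add, map_add, map_add,
    trace_mul_trace, pow_succ, pow_succ, pow_succ, ← frobPow_apply, ← frobPow_apply,
    ← frobPow_apply, map_add]
  have : b * ((frobPow F l x + frobPow F l y) * (x + y)) = b * (frobPow F l x * x) +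
    b * (frobPow F l y * y) + b * frobPow F l x * y + b * x * frobPow F l y := by ring
  rw [this, map_add, map_add, map_add]
  simp only [mul_assoc]
  ring

omit hE hF in
omit [Fintype E] [Algebra (ZMod 2) E] in
theorem mem_ker_kasamiPolar (s l : ℕ) (a : E) (b x : F) :
    x ∈ (kasamiPolar s l a b).ker ↔ polarMap s l a b x = 0 := by
  constructor
  · intro h
    refine eq_zero_of_traceMul_eq_zero fun y => ?_
    exact DFunLike.congr_fun (show kasamiPolar s l a b x = 0 from h) y
  · intro h
    ext y
    rw [kasamiPolar_apply, h]; simp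

omit [Fintype E] [Algebra (ZMod 2) E] hE in
-- Apply `Frob ^ l`. Since `Frob ^ (2 s)` is the identity, `Frob ^ (2 l)` is the square of `Frob ^
-- (s + l)`, so only powers of this one automorphism remain.
theorem polarMap_eq_zero_iff (l : ℕ) (a : E) (b x : F) :
    polarMap s l a b x = 0 ↔
      frobPow F l b * frobPow F (s + l) (frobPow F (s + l) x) +
        frobPow F l (algebraMap E F a) * frobPow F (s + l) x + b * x = 0 := by
  have h1 : frobPow F (s + l) (frobPow F (s + l) x) = frobPow F l (frobPow F l x) := by
    rw [← frobPow_add_apply, show s + l + (s + l) = s + (s + (l + l)) by ring, frobPow_add_apply,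
      frobPow_add_apply, frobPow_frobPow_half hF, frobPow_add_apply]
  have h2 : frobPow F (s + l) x = frobPow F l (frobPow F s x) := by
    rw [add_comm, frobPow_add_apply]
  rw [← map_eq_zero_iff (frobPow F l) (frobPow F l).injective, polarMap_apply, map_add, map_add,
    map_mul, map_mul, AlgEquiv.apply_symm_apply, h1, h2, add_comm (frobPow F l _ * _)]

omit [Fintype E] [Algebra (ZMod 2) E] hE in
theorem exists_card_ker_kasamiPolar (l : ℕ) {a : E} {b : F} (hab : ¬ (a = 0 ∧ b = 0)) :
    ∃ k ≤ 2, Nat.card (kasamiPolar s l a b).ker = 2 ^ ((2 * s).gcd (s + l) * k) := by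
  obtain ⟨k, hk, h⟩ := card_twisted_quadratic_eq_pow (frobPow F (s + l)).toRingEquiv
    (A := frobPow F l b) (B := frobPow F l (algebraMap E F a)) (C := b) (by
      rintro ⟨-, h1, h2⟩
      exact hab ⟨by simpa using h1, h2⟩)
  refine ⟨k, hk, ?_⟩
  rw [pow_mul, ← card_frobPow_fixed hF]
  refine Eq.trans (Nat.card_congr (Equiv.subtypeEquivRight fun x => ?_)) h
  rw [mem_ker_kasamiPolar, polarMap_eq_zero_iff hF]
  rfl

omit [Algebra (ZMod 2) E] in
-- As `d` divides `s` and `l`, the polar map is linear over the fixed field `K` of `Frob ^ d`, and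
-- composing it with the trace form of `F / K` gives an alternating `K`-form with the same kernel.
-- Its rank and `dim F = 2 s / d` are even, so the dimension of the kernel is too.
theorem even_of_card_ker_kasamiPolar {l d k : ℕ} (hd : d ∣ s) (hdl : d ∣ l)
    (hs : 0 < s) (a : E) (b : F) (hk : Nat.card (kasamiPolar s l a b).ker = 2 ^ (d * k)) :
    Even k := by
  classical
  have hd0 : 0 < d := Nat.pos_of_dvd_of_pos hd hs
  let K : Subfield F := (frobPow F d : F →+* F).eqLocusField (RingHom.id F)
  have hKd : ∀ x : K, frobPow F d x = x := fun x => x.2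
  have hKs : ∀ x : K, frobPow F s x = x := fun x => frobPow_eq_self_of_dvd (hKd x) hd
  have hKl : ∀ x : K, frobPow F l x = x := fun x => frobPow_eq_self_of_dvd (hKd x) hdl
  have hKl' : ∀ x : K, (frobPow F l).symm x = x := fun x => by
    rw [AlgEquiv.symm_apply_eq, hKl]
  have hK : Nat.card K = 2 ^ d := by
    refine (card_frobPow_fixed hF d).trans ?_
    rw [Nat.gcd_eq_right (hd.mul_left 2)]
  let L : F →ₗ[K] F :=
    { toFun := polarMap s l a b
      map_add' := map_add _
      map_smul' := by
        intro c x
        simp only [polarMap_apply, Subfield.smul_def, smul_eq_mul, map_mul, hKs, hKl, hKl',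
          RingHom.id_apply]
        ring }
  let B : LinearMap.BilinForm K F := (Algebra.traceForm K F) ∘ₗ L
  have hBker : LinearMap.ker B = LinearMap.ker L := by
    refine LinearMap.ker_comp_of_ker_eq_bot _ ?_
    rw [LinearMap.ker_eq_bot']
    exact fun m hm => (traceForm_nondegenerate K F).1 m (DFunLike.congr_fun hm)
  let σ : F ≃ₐ[K] F := AlgEquiv.ofRingEquiv (f := (frobPow F l).toRingEquiv) hKl
  let ρ : F ≃ₐ[K] F := AlgEquiv.ofRingEquiv (f := (frobPow F s).toRingEquiv) hKs
  have hB : B.IsAlt := by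
    intro x
    change Algebra.trace K F (polarMap s l a b x * x) = 0
    rw [polarMap_apply, add_mul, add_mul, map_add, map_add]
    have h1 : Algebra.trace K F ((frobPow F l).symm (b * x) * x) =
        Algebra.trace K F (b * frobPow F l x * x) := by
      rw [← Algebra.trace_eq_of_algEquiv σ]
      change Algebra.trace K F (frobPow F l _) = _
      rw [map_mul, AlgEquiv.apply_symm_apply]
      congr 1
      ring
    -- Writing `a N(x)` as a relative trace `z + ρ z` makes its trace to `K` a sum of two equal
    -- terms, hence zero.
    obtain ⟨z, hz⟩ := Algebra.trace_surjective E F (a * Algebra.norm E x)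
    have h2 : algebraMap E F a * frobPow F s x * x = z + ρ z := by
      change _ = z + frobPow F s z
      rw [← algebraMap_trace_eq hE hF, hz, map_mul, algebraMap_norm_eq hE hF]
      ring
    have h3 : ∀ t : K, t + t = 0 := fun t => Subtype.ext (add_self_of_algebra_zmod_two (t : F))
    rw [h1, h2, map_add, Algebra.trace_eq_of_algEquiv ρ, h3, zero_add, h3]
  have heven := even_finrank_add_finrank_ker_of_isAlt B hB
  have h1 : 2 ^ d < 2 ^ d * 2 ^ d := by
    have : 1 < 2 ^ d := Nat.one_lt_two_pow hd0.ne'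
    nlinarith
  have hinj : Function.Injective (fun n : ℕ => (2 ^ d) ^ n) :=
    Nat.pow_right_injective (Nat.one_lt_two_pow hd0.ne')
  have hrk : Module.finrank K (LinearMap.ker B) = k := by
    apply hinj
    change (2 ^ d) ^ _ = (2 ^ d) ^ _
    rw [← pow_mul 2 d k, ← hk, ← hK, ← Module.natCard_eq_pow_finrank (K := K), hBker]
    exact Nat.card_congr (Equiv.subtypeEquivRight fun x => by
      rw [mem_ker_kasamiPolar]; rfl)
  obtain ⟨t, rfl⟩ := hd
  have hrF : Module.finrank K F = 2 * t := by
    apply hinj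
    change (2 ^ d) ^ _ = (2 ^ d) ^ _
    rw [← pow_mul 2 d (2 * t), show d * (2 * t) = 2 * (d * t) by ring, ← hF, ← hK,
      ← Module.natCard_eq_pow_finrank (K := K), Nat.card_eq_fintype_card]
  rw [hrk, hrF, Nat.even_add] at heven
  exact heven.1 (even_two_mul t)

end KasamiForm

theorem natCard_preimage_of_surjective {A B : Type*} [AddCommGroup A] [AddCommGroup B]
    (T : A →+ B) (hT : Function.Surjective T) (p : B → Prop) :
    Nat.card {x // p (T x)} = Nat.card {y // p y} * Nat.card T.ker := by
  rw [← Nat.card_prod]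
  obtain ⟨g, hg⟩ := hT.hasRightInverse
  refine Nat.card_congr
    { toFun := fun x => (⟨T x.1, x.2⟩, ⟨x.1 - g (T x.1), by
        rw [AddMonoidHom.mem_ker, map_sub, hg, sub_self]⟩)
      invFun := fun y => ⟨g y.1.1 + y.2.1, by
        rw [map_add, hg, AddMonoidHom.mem_ker.1 y.2.2, add_zero]; exact y.1.2⟩
      left_inv := fun x => by simp
      right_inv := fun y => ?_ }
  have h : T y.2.1 = 0 := y.2.2
  ext <;> simp [hg _, h]

/-! ### The sum of all radical sizes. -/

section SecondMoment

variable {E F : Type*} [Field E] [Field F] [Fintype E] [Fintype F]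
    [Algebra (ZMod 2) E] [Algebra (ZMod 2) F] [Algebra E F]
    {s : ℕ} (hE : Fintype.card E = 2 ^ s) (hF : Fintype.card F = 2 ^ (2 * s))

include hE hF

omit [Algebra (ZMod 2) E] in
theorem frobPow_half_eq_self_iff (x : F) :
    frobPow F s x = x ↔ ∃ e : E, algebraMap E F e = x := by
  have hfix : ∀ e : E, frobPow F s (algebraMap E F e) = algebraMap E F e := fun e => by
    rw [frobPow_apply, algebraMap_pow_half hE]
  refine ⟨fun hx => ?_, fun ⟨e, he⟩ => he ▸ hfix e⟩
  let g : E → {x : F // frobPow F s x = x} := fun e => ⟨algebraMap E F e, hfix e⟩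
  have hg : Function.Injective g := fun a b h =>
    (algebraMap E F).injective (congrArg Subtype.val h)
  have hb : Function.Bijective g := hg.bijective_of_nat_card_le (by
    rw [card_frobPow_fixed hF, Nat.card_eq_fintype_card, hE, Nat.gcd_eq_right ⟨2, by ring⟩])
  obtain ⟨e, he⟩ := hb.2 ⟨x, hx⟩
  exact ⟨e, congrArg Subtype.val he⟩

/-- The condition says that the relative trace of `β` is fixed by `Frob ^ l` on `E`: there are `2 ^
gcd(s, l)` such traces, each with `2 ^ s` preimages. -/
theorem natCard_trace_fixed (l : ℕ) :
    Nat.card {β : F // frobPow F l (β + frobPow F s β) = β + frobPow F s β} =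
      2 ^ (s + s.gcd l) := by
  let T : F →+ E := (Algebra.trace E F).toAddMonoidHom
  have hT : Function.Surjective T := Algebra.trace_surjective E F
  have hker : Nat.card T.ker = 2 ^ s := by
    have h := natCard_preimage_of_surjective T hT (fun _ => True)
    rw [Nat.card_congr (Equiv.subtypeUnivEquiv fun _ => trivial),
      Nat.card_congr (Equiv.subtypeUnivEquiv fun _ => trivial), Nat.card_eq_fintype_card,
      Nat.card_eq_fintype_card, hE, hF, two_mul, pow_add] at h
    exact (mul_left_cancel₀ (by positivity) h).symm
  have h := natCard_preimage_of_surjective T hT (fun e => frobPow E l e = e)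
  rw [hker, card_frobPow_fixed hE, ← pow_add, add_comm] at h
  rw [← h]
  refine Nat.card_congr (Equiv.subtypeEquivRight fun β => ?_)
  rw [← algebraMap_trace_eq hE hF, frobPow_apply, frobPow_apply, ← map_pow,
    (algebraMap E F).injective.eq_iff]
  rfl

/-- Multiply by `x` and put `β = b x ^ (2 ^ l + 1)`: the equation becomes `a N(x) = β + Frob ^ (-l)
β`. Thus `β` determines `b` and `a`, the only constraint being that the right side lie in `E`. This
is equivalent to the relative trace of `β` being fixed by `Frob ^ l`. -/
theorem natCard_polarMap_eq_zero (l : ℕ) {x : F} (hx : x ≠ 0) :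
    Nat.card {p : E × F // polarMap s l p.1 p.2 x = 0} = 2 ^ (s + s.gcd l) := by
  rw [← natCard_trace_fixed hE hF l]
  have hσx : frobPow F l x ≠ 0 := by simpa using hx
  have hNx : Algebra.norm E x ≠ 0 := by simpa using hx
  have hiff : ∀ (a : E) (b : F), polarMap s l a b x = 0 ↔ algebraMap E F (a * Algebra.norm E x) =
      b * x * frobPow F l x + (frobPow F l).symm (b * x * frobPow F l x) := by
    intro a b
    rw [map_mul (frobPow F l).symm,
      AlgEquiv.symm_apply_apply, polarMap_apply,
      map_mul (algebraMap E F), algebraMap_norm_eq hE hF, ← mul_eq_zero_iff_right hx]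
    have h1 := add_self_of_algebra_zmod_two (b * x * frobPow F l x)
    have h2 := add_self_of_algebra_zmod_two ((frobPow F l).symm (b * x) * x)
    constructor <;> intro h
    · linear_combination h - h1 - h2
    · linear_combination h + h1 + h2
  have hcond : ∀ β : F, frobPow F l (β + frobPow F s β) = β + frobPow F s β ↔
      ∃ e : E, algebraMap E F e = β + (frobPow F l).symm β := by
    intro β
    rw [← frobPow_half_eq_self_iff hE hF]
    -- Substituting `β = Frob ^ l γ` removes the inverse Frobenius.
    obtain ⟨γ, rfl⟩ := (frobPow F l).surjective β
    rw [AlgEquiv.symm_apply_apply, map_add, map_add, frobPow_comm s l, ← map_add, ← map_add,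
      (frobPow F l).injective.eq_iff, map_add, ← sub_eq_zero, ← sub_eq_zero (b := _ + γ)]
    have h1 := add_self_of_algebra_zmod_two (frobPow F l (frobPow F s γ))
    have h2 := add_self_of_algebra_zmod_two γ
    have h3 := add_self_of_algebra_zmod_two (frobPow F s γ)
    have h4 := add_self_of_algebra_zmod_two (frobPow F l γ)
    constructor <;> intro h
    · linear_combination h + h3 - h4
    · linear_combination h - h3 + h4
  refine Nat.card_congr (Equiv.ofBijective (fun p => ⟨p.1.2 * x * frobPow F l x, (hcond _).2
    ⟨_, (hiff _ _).1 p.2⟩⟩) ⟨?_, ?_⟩)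
  · rintro ⟨⟨a, b⟩, h⟩ ⟨⟨a', b'⟩, h'⟩ hab
    simp only [Subtype.mk.injEq] at hab
    have hb : b = b' := mul_right_cancel₀ hx (mul_right_cancel₀ hσx hab)
    subst hb
    rw [hiff] at h h'
    have ha := (algebraMap E F).injective (h.trans h'.symm)
    obtain rfl : a = a' := mul_right_cancel₀ hNx ha
    rfl
  · rintro ⟨β, hβ⟩
    obtain ⟨e, he⟩ := (hcond β).1 hβ
    have hβ' : β / (x * frobPow F l x) * x * frobPow F l x = β := by field_simp
    refine ⟨⟨(e / Algebra.norm E x, β / (x * frobPow F l x)), (hiff _ _).2 ?_⟩,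
      Subtype.ext hβ'⟩
    rw [hβ', div_mul_cancel₀ _ hNx, he]

theorem sum_natCard_ker_kasamiPolar (l : ℕ) :
    ∑ p : E × F, Nat.card (kasamiPolar s l p.1 p.2).ker =
      2 ^ (3 * s) + (2 ^ (2 * s) - 1) * 2 ^ (s + s.gcd l) := by
  classical
  have h1 : ∀ p : E × F, Nat.card (kasamiPolar s l p.1 p.2).ker =
      ∑ x : F, if polarMap s l p.1 p.2 x = 0 then 1 else 0 := by
    intro p
    rw [← Finset.card_filter, ← Fintype.card_subtype, ← Nat.card_eq_fintype_card]
    exact Nat.card_congr (Equiv.subtypeEquivRight fun x => mem_ker_kasamiPolar _ _ _ _ _)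
  simp only [h1]
  rw [Finset.sum_comm, ← Finset.add_sum_erase _ _ (Finset.mem_univ 0)]
  congr 1
  · simp [hE, hF]; ring
  · rw [Finset.sum_congr rfl (g := fun _ => 2 ^ (s + s.gcd l))]
    · rw [Finset.sum_const, Finset.card_erase_of_mem (Finset.mem_univ _), Finset.card_univ, hF,
        smul_eq_mul]
    · intro x hx
      rw [← Finset.card_filter, ← Fintype.card_subtype, ← Nat.card_eq_fintype_card]
      exact natCard_polarMap_eq_zero hE hF l (Finset.ne_of_mem_erase hx)

end SecondMoment

/-! ### Exponential sums invariant under roots of unity. -/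

section Congruence

variable {F : Type*} [Field F] [Fintype F]

/-- A sign sum over a finite field that is invariant under multiplication by the `n`-th roots of
unity is determined modulo `n` by the value at zero. -/
theorem dvd_expSum_sub_of_invariant {n : ℕ} (hn : n ∣ Fintype.card F - 1) (f : F → ZMod 2)
    (hf : ∀ u x : F, u ^ n = 1 → f (u * x) = f x) (h0 : f 0 = 0) :
    (n : ℤ) ∣ expSum f - 1 := by
  classical
  have hker : (Finset.univ.filter fun u : Fˣ => u ^ n = 1).card = n := by
    rw [← Fintype.card_subtype, ← Nat.card_eq_fintype_card, card_units_pow_eq_one,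
      Nat.gcd_eq_right hn]
  have h1 : expSum f - 1 = ∑ u : Fˣ, signChar (f u) := by
    rw [expSum, Fintype.sum_eq_add_sum_subtype_ne _ (0 : F), h0, signChar_zero, add_sub_cancel_left]
    exact (Equiv.sum_comp (unitsEquivNeZero (G₀ := F)) fun x => signChar (f x)).symm
  rw [h1, ← Finset.sum_fiberwise_of_maps_to (s := Finset.univ)
    (t := Finset.univ.image fun u : Fˣ => u ^ n) (g := fun u => u ^ n)
    (fun u _ => Finset.mem_image_of_mem _ (Finset.mem_univ u))]
  refine Finset.dvd_sum fun y hy => ?_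
  obtain ⟨v, -, rfl⟩ := Finset.mem_image.1 hy
  have hcard := MonoidHom.card_fiber_eq_of_mem_range (powMonoidHom n : Fˣ →* Fˣ)
    (x := v ^ n) (y := 1) ⟨v, rfl⟩ ⟨1, by simp⟩
  simp only [powMonoidHom_apply] at hcard
  rw [Finset.sum_congr rfl (g := fun _ => signChar (f v)), Finset.sum_const, hcard, hker,
    nsmul_eq_mul]
  · exact dvd_mul_right _ _
  · intro u hu
    have hu' : u ^ n = v ^ n := (Finset.mem_filter.1 hu).2
    have h2 : ((u / v : Fˣ) : F) ^ n = 1 := by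
      rw [← Units.val_pow_eq_pow_val, div_pow, hu', div_self', Units.val_one]
    rw [← hf _ (v : F) h2, ← Units.val_mul, div_mul_cancel]

end Congruence

/-! ### The sum of the untwisted exponential sums, and their signs. -/

section FirstMoment

variable {E F : Type*} [Field E] [Field F] [Fintype E] [Fintype F]
    [Algebra (ZMod 2) E] [Algebra (ZMod 2) F] [Algebra E F]
    {s : ℕ} (hE : Fintype.card E = 2 ^ s) (hF : Fintype.card F = 2 ^ (2 * s))

omit [Fintype E] in
theorem kasamiForm_zero (l : ℕ) (a : E) (b : F) : kasamiForm l a b 0 = 0 := by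
  have : Algebra.norm E (0 : F) = 0 := by simp
  simp [kasamiForm, this]

include hE hF

/-- For fixed `x ≠ 0` the value is a nonzero character of `(a, b)`, already through `a` since `N(x)
≠ 0`. Only `x = 0` contributes. -/
theorem sum_expSum_kasamiForm (l : ℕ) :
    ∑ p : E × F, expSum (kasamiForm l p.1 p.2) = 2 ^ (3 * s) := by
  simp only [expSum]
  rw [Finset.sum_comm, Finset.sum_eq_single 0]
  · simp [kasamiForm_zero, hE, hF]
    ring
  · intro x _ hx
    let φ : E × F →+ ZMod 2 :=
      ((traceMul E).flip (Algebra.norm E x)).coprod ((traceMul F).flip (x ^ (2 ^ l + 1)))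
    have hφ : φ ≠ 0 := by
      intro h
      have hN : Algebra.norm E x ≠ 0 := by simpa using hx
      refine hN (eq_zero_of_traceMul_eq_zero' fun a => ?_)
      have := DFunLike.congr_fun h (a, 0)
      simpa [φ] using this
    exact sum_signChar_of_ne_zero φ hφ
  · simp

/-- Oddness of `n` and `k` makes `2 ^ d + 1` divide `2 ^ s + 1` and `2 ^ l + 1`, so multiplying `x`
by a root of unity of that order changes neither `N(x)` nor `x ^ (2 ^ l + 1)`. -/
theorem two_pow_add_one_dvd_expSum_kasamiForm_sub_one {l d : ℕ} {n k : ℕ} (hn : Odd n) (hk : Odd k)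
    (hs : s = d * n) (hl : l = d * k) (a : E) (b : F) :
    (2 ^ d + 1 : ℤ) ∣ expSum (kasamiForm l a b) - 1 := by
  have hdvd : ∀ j : ℕ, Odd j → 2 ^ d + 1 ∣ 2 ^ (d * j) + 1 := fun j hj => by
    simpa [pow_mul] using hj.nat_add_dvd_pow_add_pow (2 ^ d) 1
  have hds : 2 ^ d + 1 ∣ 2 ^ s + 1 := hs ▸ hdvd n hn
  have hdl : 2 ^ d + 1 ∣ 2 ^ l + 1 := hl ▸ hdvd k hk
  have hpow : ∀ (u : F) (j : ℕ), u ^ (2 ^ d + 1) = 1 → 2 ^ d + 1 ∣ j → u ^ j = 1 := by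
    rintro u j hu ⟨t, rfl⟩
    rw [pow_mul, hu, one_pow]
  have h := dvd_expSum_sub_of_invariant (n := 2 ^ d + 1) (F := F) (by
      rw [hF, mul_comm, pow_mul]
      refine hds.trans ⟨2 ^ s - 1, ?_⟩
      rw [← Nat.sq_sub_sq, one_pow])
    (kasamiForm l a b) (by
      intro u x hu
      have hNu : Algebra.norm E u = 1 := by
        apply (algebraMap E F).injective
        rw [algebraMap_norm_eq hE hF, frobPow_apply, ← pow_succ', map_one, hpow u _ hu hds]
      rw [kasamiForm, kasamiForm, map_mul (Algebra.norm E), hNu, one_mul, mul_pow,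
        hpow u _ hu hdl, one_mul])
    (kasamiForm_zero l a b)
  exact_mod_cast h

/-- Modulo `2 ^ d + 1` the sum is `1`, while `2 ^ (s + d r)` is `(-1) ^ (n + r)`. The value zero
would force `2 ^ d + 1` to divide `1`, and the wrong sign would force it to divide `2`. -/
theorem expSum_kasamiForm_eq {l d : ℕ} {n k r : ℕ} (hd : 0 < d) (hn : Odd n) (hk : Odd k)
    (hs : s = d * n) (hl : l = d * k) (a : E) (b : F)
    (hr : Nat.card (kasamiPolar s l a b).ker = 2 ^ (2 * d * r)) :
    expSum (kasamiForm l a b) = -((-1) ^ r * 2 ^ (s + d * r)) := by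
  have h1 := two_pow_add_one_dvd_expSum_kasamiForm_sub_one hE hF hn hk hs hl a b
  have hd2 : (2 : ℤ) ≤ 2 ^ d := by
    calc (2 : ℤ) = 2 ^ 1 := by norm_num
      _ ≤ 2 ^ d := pow_le_pow_right₀ (by norm_num) hd
  have hdm : (2 : ℤ) ^ d ≡ -1 [ZMOD 2 ^ d + 1] :=
    (Int.modEq_iff_dvd.2 ⟨-1, by ring⟩)
  have hmod : (-1) ^ r * (2 : ℤ) ^ (s + d * r) ≡ -1 [ZMOD 2 ^ d + 1] := by
    have h2 := ((hdm.pow (n + r)).mul_left ((-1) ^ r))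
    rw [← pow_mul, mul_add, ← hs, ← pow_add (-1 : ℤ), show r + (n + r) = n + (r + r) by ring,
      pow_add (-1 : ℤ), hn.neg_one_pow, (Even.add_self r).neg_one_pow, mul_one] at h2
    exact h2
  have hT : (1 : ℤ) ≡ expSum (kasamiForm l a b) [ZMOD 2 ^ d + 1] := Int.modEq_iff_dvd.2 h1
  rcases expSum_sq_eq_zero_or (kasamiForm_add hE hF l a b) with h | h
  · rw [sq_eq_zero_iff.1 h] at h1
    have := Int.le_of_dvd one_pos (by simpa using h1)
    lia
  · rw [hr, hF] at h
    have h3 : expSum (kasamiForm l a b) ^ 2 = ((-1) ^ r * 2 ^ (s + d * r)) ^ 2 := by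
      rw [h, mul_pow, ← pow_mul, (even_two.mul_left r).neg_one_pow, one_mul]
      push_cast
      rw [← pow_add, ← pow_mul]
      congr 1
      ring
    rcases sq_eq_sq_iff_eq_or_eq_neg.1 h3 with h4 | h4
    · rw [h4] at hT
      have := Int.le_of_dvd two_pos (by simpa using! (hT.trans hmod).symm.dvd)
      lia
    · exact h4

end FirstMoment

/-! ### Counting with the additive constant as a sign. -/

section SignedCount

variable {Q : Type*}

theorem signChar_injective : Function.Injective signChar := by
  unfold Function.Injective; decide

theorem signChar_ne_zero (t : ZMod 2) : signChar t ≠ 0 := by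
  revert t; decide

theorem signChar_sq (t : ZMod 2) : signChar t ^ 2 = 1 := by
  revert t; decide

/-- Whenever `S q` is `t` or `-t`, exactly one sign turns it into `t`. This is the source of the
symmetry of the weight distribution. -/
theorem natCard_signChar_mul_eq (S : Q → ℤ) {t : ℤ} (ht : t ≠ 0) :
    Nat.card {y : Q × ZMod 2 // signChar y.2 * S y.1 = t} = Nat.card {q // S q ^ 2 = t ^ 2} := by
  refine Nat.card_congr (Equiv.ofBijective (fun y => ⟨y.1.1, ?_⟩) ⟨?_, ?_⟩)
  · have h := congrArg (· ^ 2) y.2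
    simpa only [mul_pow, signChar_sq, one_mul] using h
  · rintro ⟨⟨q, h⟩, hy⟩ ⟨⟨q', h'⟩, hy'⟩ hq
    obtain rfl : q = q' := congrArg Subtype.val hq
    dsimp only at hy hy'
    have hS : S q ≠ 0 := by
      intro h0
      rw [h0, mul_zero] at hy
      exact ht hy.symm
    obtain rfl : h = h' := signChar_injective (mul_right_cancel₀ hS (hy.trans hy'.symm))
    rfl
  · rintro ⟨q, hq⟩
    rcases sq_eq_sq_iff_eq_or_eq_neg.1 hq with h | h
    · exact ⟨⟨(q, 0), by simpa using h⟩, rfl⟩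
    · exact ⟨⟨(q, 1), by simp [signChar_one, h]⟩, rfl⟩

theorem natCard_signChar_mul_eq_zero (S : Q → ℤ) :
    Nat.card {y : Q × ZMod 2 // signChar y.2 * S y.1 = 0} = 2 * Nat.card {q // S q = 0} := by
  have h : Nat.card ({q // S q = 0} × ZMod 2) = 2 * Nat.card {q // S q = 0} := by
    rw [Nat.card_prod, Nat.card_zmod, mul_comm]
  rw [← h]
  exact Nat.card_congr
    { toFun := fun y => (⟨y.1.1, (mul_eq_zero.1 y.2).resolve_left (signChar_ne_zero _)⟩, y.1.2)
      invFun := fun y => ⟨(y.1.1, y.2), by rw [y.1.2, mul_zero]⟩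
      left_inv := fun _ => rfl
      right_inv := fun _ => rfl }

theorem natCard_subtype_prod {A B : Type*} [Fintype A] [Finite B] (P : A × B → Prop) :
    Nat.card {q // P q} = ∑ a, Nat.card {b // P (a, b)} := by
  rw [← Nat.card_sigma]
  exact Nat.card_congr (Equiv.subtypeProdEquivSigmaSubtype fun a b => P (a, b))

theorem sum_signChar_eq_sub_hammingNorm {V : Type*} [Fintype V] (w : V → ZMod 2) :
    ∑ x, signChar (w x) = Fintype.card V - 2 * (hammingNorm w : ℤ) := by
  have h : ∀ t : ZMod 2, signChar t = 1 - 2 * (if t ≠ 0 then 1 else 0) := by decide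
  simp only [h, Finset.sum_sub_distrib, ← Finset.mul_sum, ← Finset.sum_filter]
  simp [hammingNorm]

end SignedCount

/-! ### From radical sizes to values of the exponential sums. -/

section Counting

variable {E F : Type*} [Field E] [Field F] [Fintype E] [Fintype F]
    [Algebra (ZMod 2) E] [Algebra (ZMod 2) F] [Algebra E F]
    {s : ℕ} (hE : Fintype.card E = 2 ^ s) (hF : Fintype.card F = 2 ^ (2 * s))

/-- The number of elements of the radical of `kasamiForm`. -/
noncomputable def radCard (s l : ℕ) (p : E × F) : ℕ := Nat.card (kasamiPolar s l p.1 p.2).ker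

/-- The exponential sum of `kasamiForm` twisted by a linear function. -/
noncomputable def kasamiSum (l : ℕ) (q : (E × F) × F) : ℤ :=
  expSum fun x => kasamiForm l q.1.1 q.1.2 x + traceMul F q.2 x

omit [Fintype E] [Algebra (ZMod 2) E] in
theorem radCard_pos (l : ℕ) (p : E × F) : 0 < radCard s l p := Nat.card_pos

omit [Fintype E] [Algebra (ZMod 2) E] in
include hF in
theorem radCard_zero (l : ℕ) : radCard s l (0 : E × F) = 2 ^ (2 * s) := by
  rw [← hF, ← Nat.card_eq_fintype_card]
  refine Nat.card_congr (Equiv.subtypeUnivEquiv fun x => ?_)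
  rw [mem_ker_kasamiPolar, polarMap_apply]
  simp

include hE hF

theorem kasamiSum_sq (l : ℕ) (q : (E × F) × F) :
    kasamiSum l q ^ 2 = 0 ∨ kasamiSum l q ^ 2 = 2 ^ (2 * s) * radCard s l q.1 := by
  have h := expSum_sq_eq_zero_or
    (f := fun x => kasamiForm l q.1.1 q.1.2 x + traceMul F q.2 x)
    (polar_add_linear (kasamiForm_add hE hF l q.1.1 q.1.2) (traceMul F q.2))
  rw [hF] at h
  exact_mod_cast h

theorem natCard_kasamiSum_sq_eq_mul (l : ℕ) (p : E × F) :
    Nat.card {c : F // kasamiSum l (p, c) ^ 2 = 2 ^ (2 * s) * radCard s l p} * radCard s l p =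
      2 ^ (2 * s) := by
  have h := card_expSum_ne_zero_mul (kasamiForm_add hE hF l p.1 p.2) (P := traceMul F)
    fun y hy => eq_zero_of_traceMul_eq_zero' hy
  rw [hF] at h
  exact_mod_cast h

/-- A nonzero squared sum reveals the radical size, so only pairs with radical of size `r`
contribute, each with `2 ^ (2 s) / r` values of `c`. -/
theorem natCard_kasamiSum_sq_mul (l : ℕ) {r : ℕ} (hr : 0 < r) :
    Nat.card {q : (E × F) × F // kasamiSum l q ^ 2 = 2 ^ (2 * s) * r} * r =
      Nat.card {p : E × F // radCard s l p = r} * 2 ^ (2 * s) := by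
  classical
  rw [natCard_subtype_prod, Nat.card_eq_fintype_card, Fintype.card_subtype, Finset.card_filter,
    Finset.sum_mul, Finset.sum_mul]
  refine Finset.sum_congr rfl fun p _ => ?_
  split_ifs with h
  · rw [one_mul, ← h, natCard_kasamiSum_sq_eq_mul hE hF]
  · rw [zero_mul, mul_eq_zero]
    left
    rw [Nat.card_eq_zero]
    left
    refine ⟨fun c => h ?_⟩
    have hc := c.2
    rcases kasamiSum_sq hE hF l (p, c.1) with h1 | h1
    · rw [h1] at hc
      have : (0 : ℤ) < 2 ^ (2 * s) * r := by positivity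
      lia
    · rw [h1] at hc
      exact_mod_cast mul_left_cancel₀ (by positivity) hc

theorem natCard_kasamiSum_eq_zero (l : ℕ) :
    (Nat.card {q : (E × F) × F // kasamiSum l q = 0} : ℚ) =
      ∑ p : E × F, (2 ^ (2 * s) - 2 ^ (2 * s) / (radCard s l p : ℚ)) := by
  classical
  rw [natCard_subtype_prod, Nat.cast_sum]
  refine Finset.sum_congr rfl fun p _ => ?_
  have hr : (radCard s l p : ℚ) ≠ 0 := by exact_mod_cast (radCard_pos l p).ne'
  have h := natCard_kasamiSum_sq_eq_mul hE hF l p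
  have h1 : (Nat.card {c : F // kasamiSum l (p, c) ^ 2 = 2 ^ (2 * s) * radCard s l p} : ℚ) =
      2 ^ (2 * s) / (radCard s l p : ℚ) := by
    rw [eq_div_iff hr]; exact_mod_cast h
  rw [← h1, eq_sub_iff_add_eq]
  have h2 : Nat.card {c : F // kasamiSum l (p, c) ^ 2 = 2 ^ (2 * s) * radCard s l p} =
      Nat.card {c : F // ¬ kasamiSum l (p, c) = 0} := by
    refine Nat.card_congr (Equiv.subtypeEquivRight fun c => ⟨fun hc h0 => ?_, fun h0 => ?_⟩)
    · rw [h0] at hc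
      have := radCard_pos (s := s) l p
      have : (0 : ℤ) < 2 ^ (2 * s) * radCard s l p := by positivity
      lia
    · exact (kasamiSum_sq hE hF l (p, c)).resolve_left fun h3 => h0 (sq_eq_zero_iff.1 h3)
  rw [h2, Nat.card_eq_fintype_card, Nat.card_eq_fintype_card]
  have h3 := Fintype.card_subtype_compl fun c : F => kasamiSum l (p, c) = 0
  have h4 := Fintype.card_subtype_le fun c : F => kasamiSum l (p, c) = 0
  rw [h3, ← Nat.cast_add, Nat.add_sub_cancel' h4, hF]
  push_cast; rfl

end Counting

/-! ### Parametrisation of the code, its dimension and its weights. -/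

section Codewords

variable {E F : Type*} [Field E] [Field F] [Fintype E] [Fintype F]
    [Algebra (ZMod 2) E] [Algebra (ZMod 2) F] [Algebra E F]
    {s : ℕ} (hE : Fintype.card E = 2 ^ s) (hF : Fintype.card F = 2 ^ (2 * s))

/-- The codeword with parameters `((a, b), c)` and `h`. -/
noncomputable def kasamiWord (l : ℕ) (q : ((E × F) × F) × ZMod 2) (x : F) : ZMod 2 :=
  kasamiForm l q.1.1.1 q.1.1.2 x + traceMul F q.1.2 x + q.2

omit [Fintype E] [Fintype F] in
theorem kasamiWord_sub (l : ℕ) (q q' : ((E × F) × F) × ZMod 2) :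
    kasamiWord l (q - q') = kasamiWord l q - kasamiWord l q' := by
  ext x
  simp only [kasamiWord, kasamiForm, Prod.fst_sub, Prod.snd_sub, sub_mul, map_sub, Pi.sub_apply,
    AddMonoidHom.sub_apply]
  ring

omit [Fintype E] in
theorem signChar_mul_kasamiSum (l : ℕ) (q : ((E × F) × F) × ZMod 2) :
    signChar q.2 * kasamiSum l q.1 = Fintype.card F - 2 * (hammingNorm (kasamiWord l q) : ℤ) := by
  rw [← sum_signChar_eq_sub_hammingNorm, kasamiSum, expSum, Finset.mul_sum]
  refine Finset.sum_congr rfl fun x _ => ?_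
  rw [kasamiWord, signChar_add _ q.2, mul_comm]

include hE hF

theorem mem_generalizedKasamiCode_iff (l : ℕ) (w : F → ZMod 2) :
    w ∈ generalizedKasamiCode E F s l ↔
      ∃ q : ((E × F) × F) × ZMod 2, kasamiWord l q = w := by
  have key : ∀ (a y : E) (x : F), algebraMap E F y = algebraMap E F a * x ^ (2 ^ s + 1) ↔
      y = a * Algebra.norm E x := by
    intro a y x
    rw [← (algebraMap E F).injective.eq_iff, map_mul, algebraMap_norm_eq hE hF, frobPow_apply,
      pow_succ']
  change (∃ (a : E) (b c : F) (h : ZMod 2), ∀ x : F, ∃ y : E, _ ∧ _) ↔ _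
  simp only [key, exists_eq_left]
  constructor
  · rintro ⟨a, b, c, h, hw⟩
    refine ⟨(((a, b), c), h), funext fun x => ?_⟩
    rw [hw, kasamiWord, kasamiForm, traceMul_apply, map_add]
    ring
  · rintro ⟨⟨⟨⟨a, b⟩, c⟩, h⟩, rfl⟩
    refine ⟨a, b, c, h, fun x => ?_⟩
    rw [kasamiWord, kasamiForm, traceMul_apply, map_add]
    ring

/-- The zero word has exponential sum `2 ^ (2 s)`, whose square forces the radical to be everything.
So `(a, b) = 0`, and nondegeneracy of the trace gives `c = 0`. -/
theorem kasamiWord_injective {l : ℕ}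
    (hr : ∀ p : E × F, p ≠ 0 → radCard s l p ≠ 2 ^ (2 * s)) :
    Function.Injective (kasamiWord (E := E) (F := F) l) := by
  intro q q' hq
  rw [← sub_eq_zero, ← kasamiWord_sub] at hq
  rw [← sub_eq_zero]
  generalize q - q' = v at hq
  obtain ⟨⟨p, c⟩, h⟩ := v
  have hx : ∀ x, kasamiForm l p.1 p.2 x + traceMul F c x + h = 0 := fun x => congrFun hq x
  obtain rfl : h = 0 := by simpa [kasamiForm_zero] using hx 0
  have hS := signChar_mul_kasamiSum l ((p, c), (0 : ZMod 2))
  rw [hq, hammingNorm_zero, signChar_zero, hF] at hS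
  have hp : p = 0 := by
    by_contra hp
    have hpos : (0 : ℤ) < 2 ^ (2 * s) := by positivity
    rcases kasamiSum_sq hE hF l (p, c) with h1 | h1
    · rw [sq_eq_zero_iff] at h1
      rw [h1] at hS
      push_cast at hS
      lia
    · apply hr p hp
      have h2 : kasamiSum l (p, c) = 2 ^ (2 * s) := by simpa using hS
      rw [h2, sq] at h1
      exact_mod_cast (mul_left_cancel₀ hpos.ne' h1).symm
  subst hp
  have hc : c = 0 := eq_zero_of_traceMul_eq_zero fun y => by simpa [kasamiForm] using hx y
  rw [hc]
  rfl

theorem finrank_generalizedKasamiCode {l : ℕ}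
    (hr : ∀ p : E × F, p ≠ 0 → radCard s l p ≠ 2 ^ (2 * s)) :
    Module.finrank (ZMod 2) (generalizedKasamiCode E F s l) = 5 * s + 1 := by
  have hinj := kasamiWord_injective hE hF hr
  have h1 : Nat.card (generalizedKasamiCode E F s l) = 2 ^ (5 * s + 1) := by
    rw [Nat.card_congr (Equiv.subtypeEquivRight fun w => mem_generalizedKasamiCode_iff hE hF l w)]
    refine (Nat.card_congr (Equiv.ofInjective _ hinj)).symm.trans ?_
    simp only [Nat.card_prod, Nat.card_zmod]
    rw [Nat.card_eq_fintype_card, Nat.card_eq_fintype_card, hE, hF]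
    ring
  rw [Module.natCard_eq_pow_finrank (K := ZMod 2), Nat.card_zmod] at h1
  exact Nat.pow_right_injective le_rfl h1

theorem weightCount_eq_natCard {l : ℕ}
    (hr : ∀ p : E × F, p ≠ 0 → radCard s l p ≠ 2 ^ (2 * s)) (i : ℕ) :
    weightCount (generalizedKasamiCode E F s l) i =
      Nat.card {q : ((E × F) × F) × ZMod 2 // signChar q.2 * kasamiSum l q.1 =
        2 ^ (2 * s) - 2 * (i : ℤ)} := by
  have h1 : {w | w ∈ generalizedKasamiCode E F s l ∧ hammingNorm w = i} =
      kasamiWord l '' {q : ((E × F) × F) × ZMod 2 |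
        signChar q.2 * kasamiSum l q.1 = 2 ^ (2 * s) - 2 * (i : ℤ)} := by
    ext w
    simp only [Set.mem_ofPred_eq, Set.mem_image, mem_generalizedKasamiCode_iff hE hF,
      signChar_mul_kasamiSum, hF]
    push_cast
    constructor
    · rintro ⟨⟨q, rfl⟩, h⟩
      exact ⟨q, by rw [h], rfl⟩
    · rintro ⟨q, h, rfl⟩
      exact ⟨⟨q, rfl⟩, by lia⟩
  rw [weightCount, h1, Set.ncard_image_of_injective _ (kasamiWord_injective hE hF hr)]
  rfl

theorem weightCount_mul {l : ℕ}
    (hr : ∀ p : E × F, p ≠ 0 → radCard s l p ≠ 2 ^ (2 * s)) {i r : ℕ} (hr0 : 0 < r)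
    (hi : (2 ^ (2 * s) - 2 * (i : ℤ)) ^ 2 = 2 ^ (2 * s) * r) :
    weightCount (generalizedKasamiCode E F s l) i * r =
      Nat.card {p : E × F // radCard s l p = r} * 2 ^ (2 * s) := by
  have ht : (2 ^ (2 * s) - 2 * (i : ℤ)) ≠ 0 := by
    intro h
    rw [h] at hi
    have : (0 : ℤ) < 2 ^ (2 * s) * r := by positivity
    lia
  rw [weightCount_eq_natCard hE hF hr, natCard_signChar_mul_eq _ ht, hi,
    natCard_kasamiSum_sq_mul hE hF l hr0]

theorem weightCount_middle {l : ℕ}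
    (hr : ∀ p : E × F, p ≠ 0 → radCard s l p ≠ 2 ^ (2 * s)) {i : ℕ} (hi : 2 * i = 2 ^ (2 * s)) :
    (weightCount (generalizedKasamiCode E F s l) i : ℚ) =
      2 * ∑ p : E × F, (2 ^ (2 * s) - 2 ^ (2 * s) / (radCard s l p : ℚ)) := by
  have ht : (2 ^ (2 * s) - 2 * (i : ℤ)) = 0 := by
    rw [sub_eq_zero]; exact_mod_cast hi.symm
  rw [weightCount_eq_natCard hE hF hr, ht, natCard_signChar_mul_eq_zero, Nat.cast_mul,
    natCard_kasamiSum_eq_zero hE hF]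
  rfl

theorem exists_radCard_of_weightCount_ne_zero {l : ℕ}
    (hr : ∀ p : E × F, p ≠ 0 → radCard s l p ≠ 2 ^ (2 * s)) {i : ℕ}
    (hi : weightCount (generalizedKasamiCode E F s l) i ≠ 0) (hmid : 2 * i ≠ 2 ^ (2 * s)) :
    ∃ p : E × F, (2 ^ (2 * s) - 2 * (i : ℤ)) ^ 2 = 2 ^ (2 * s) * radCard s l p := by
  rw [weightCount_eq_natCard hE hF hr, Nat.card_ne_zero] at hi
  obtain ⟨⟨⟨q, h⟩, hq⟩⟩ := hi.1
  refine ⟨q.1, ?_⟩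
  rw [← hq, mul_pow, signChar_sq, one_mul]
  refine (kasamiSum_sq hE hF l q).resolve_left fun h0 => hmid ?_
  rw [sq_eq_zero_iff.1 h0, mul_zero] at hq
  zify
  lia

end Codewords

/-! ### Greatest common divisors, and weights as solutions of a square equation. -/

section Arithmetic

theorem gcd_add_two_mul_comm (s l : ℕ) : (s + l).gcd (2 * l) = (2 * s).gcd (s + l) := by
  apply Nat.dvd_antisymm
  · refine Nat.dvd_gcd ?_ (Nat.gcd_dvd_left _ _)
    rw [Nat.dvd_add_iff_left (Nat.gcd_dvd_right (s + l) (2 * l)), ← mul_add]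
    exact (Nat.gcd_dvd_left _ _).mul_left 2
  · refine Nat.dvd_gcd (Nat.gcd_dvd_right _ _) ?_
    rw [Nat.dvd_add_iff_right (Nat.gcd_dvd_left (2 * s) (s + l)), ← mul_add]
    exact (Nat.gcd_dvd_right _ _).mul_left 2

/-- A divisor of `2 s` that is at least `s` is `s` or `2 s`; dividing `s + l`, it would make `l` a
multiple of `s`, which the range of `l` excludes. -/
theorem gcd_two_mul_add_lt {s l : ℕ} (hl : 1 ≤ l) (hls : l < 2 * s) (hne : l ≠ s) :
    (2 * s).gcd (s + l) < s := by
  by_contra! h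
  obtain ⟨c, hc⟩ := Nat.gcd_dvd_left (2 * s) (s + l)
  have hdvd := Nat.gcd_dvd_right (2 * s) (s + l)
  generalize (2 * s).gcd (s + l) = g at *
  have hc2 : c ≤ 2 := by
    by_contra! h3
    nlinarith
  have hsg : s ∣ g := by
    interval_cases c
    · lia
    · exact ⟨2, by lia⟩
    · exact ⟨1, by lia⟩
  obtain ⟨e, rfl⟩ := (Nat.dvd_add_right (dvd_refl s)).1 (hsg.trans hdvd)
  have h1 : e < 2 := by
    by_contra! h3
    nlinarith
  interval_cases e <;> lia

theorem weight_sq {s u i : ℕ} (hu : 1 ≤ u) (hus : u ≤ 2 * s)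
    (hi : i = 2 ^ (2 * s - 1) - 2 ^ (u - 1) ∨ i = 2 ^ (2 * s - 1) + 2 ^ (u - 1)) :
    ((2 : ℤ) ^ (2 * s) - 2 * (i : ℤ)) ^ 2 = 2 ^ (2 * u) := by
  obtain ⟨m, hm⟩ : ∃ m, 2 * s = m + 1 := ⟨2 * s - 1, by lia⟩
  obtain ⟨v, rfl⟩ : ∃ v, u = v + 1 := ⟨u - 1, by lia⟩
  rw [hm, Nat.add_sub_cancel, Nat.add_sub_cancel] at hi
  have hle : 2 ^ v ≤ 2 ^ m := Nat.pow_le_pow_right two_pos (by lia)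
  rw [hm]
  rcases hi with rfl | rfl
  · push_cast [Nat.cast_sub hle]
    ring
  · push_cast
    ring

/-- The boundary case `u = 2 s` is allowed on purpose: it gives the weights `0` and `2 ^ (2 s)` of
the pair `(0, 0)`. -/
theorem eq_weight_of_sq {s u i : ℕ} (hu : 1 ≤ u) (hus : u ≤ 2 * s)
    (h : ((2 : ℤ) ^ (2 * s) - 2 * (i : ℤ)) ^ 2 = 2 ^ (2 * u)) :
    i = 2 ^ (2 * s - 1) - 2 ^ (u - 1) ∨ i = 2 ^ (2 * s - 1) + 2 ^ (u - 1) := by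
  obtain ⟨m, hm⟩ : ∃ m, 2 * s = m + 1 := ⟨2 * s - 1, by lia⟩
  obtain ⟨v, rfl⟩ : ∃ v, u = v + 1 := ⟨u - 1, by lia⟩
  rw [hm, Nat.add_sub_cancel, Nat.add_sub_cancel]
  have hle : 2 ^ v ≤ 2 ^ m := Nat.pow_le_pow_right two_pos (by lia)
  rw [hm, mul_comm 2 (v + 1), pow_mul, sq_eq_sq_iff_eq_or_eq_neg, pow_succ, pow_succ] at h
  zify [hle]
  rcases h with h | h
  · left; lia
  · right; lia

end Arithmetic

/-! ### Weight counts and moment equations in terms of radical multiplicities. -/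

section Distribution

variable {E F : Type*} [Field E] [Field F] [Fintype E] [Fintype F]
    [Algebra (ZMod 2) E] [Algebra (ZMod 2) F] [Algebra E F]
    {s : ℕ} (hE : Fintype.card E = 2 ^ s) (hF : Fintype.card F = 2 ^ (2 * s))

variable (E F) in
/-- The number of nonzero pairs `(a, b)` for which the radical of `kasamiForm` has `2 ^ e`
elements. -/
noncomputable def radCount (s l e : ℕ) : ℕ :=
  Nat.card {p : E × F // p ≠ 0 ∧ radCard s l p = 2 ^ e}

omit [Algebra (ZMod 2) E] in
-- Common source of the moment equations and of the middle weight: any quantity depending on a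
-- nonzero pair only through its radical size is summed by multiplicities, with the zero pair split
-- off.
theorem sum_eq_of_radCard {l d K : ℕ} (hd : 0 < d)
    (hrad : ∀ p : E × F, p ≠ 0 → ∃ k ≤ K, radCard s l p = 2 ^ (2 * d * k))
    (G : E × F → ℚ) (W : ℕ → ℚ)
    (hG : ∀ p, p ≠ 0 → ∀ j, radCard s l p = 2 ^ (2 * d * j) → G p = W j) :
    ∑ p, G p = G 0 + ∑ j ∈ Finset.range (K + 1), radCount E F s l (2 * d * j) * W j := by
  classical
  have hinj : ∀ j k : ℕ, 2 ^ (2 * d * j) = 2 ^ (2 * d * k) → j = k := fun j k h =>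
    Nat.eq_of_mul_eq_mul_left (by lia) (Nat.pow_right_injective le_rfl h)
  choose! J hJK hJ using hrad
  rw [← Finset.add_sum_erase _ _ (Finset.mem_univ 0), ← Finset.sum_fiberwise_of_maps_to (g := J)
    (t := Finset.range (K + 1))]
  · congr 1
    refine Finset.sum_congr rfl fun j _ => ?_
    rw [Finset.sum_congr rfl (g := fun _ => W j), Finset.sum_const, nsmul_eq_mul, radCount,
      Nat.card_eq_fintype_card, Fintype.card_subtype]
    · congr 3
      ext p
      simp only [Finset.mem_filter, Finset.mem_erase, Finset.mem_univ, and_true, true_and]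
      exact and_congr_right fun hp => ⟨fun h => h ▸ hJ p hp,
        fun h => hinj _ _ ((hJ p hp).symm.trans h)⟩
    · intro p hp
      obtain ⟨hp', rfl⟩ := Finset.mem_filter.1 hp
      have hp0 := Finset.ne_of_mem_erase hp'
      exact hG p hp0 _ (hJ p hp0)
  · intro p hp
    have := hJK p (Finset.ne_of_mem_erase hp)
    exact Finset.mem_range.2 (by lia)

omit [Fintype E] [Algebra (ZMod 2) E] in
include hF in
theorem natCard_radCard_eq {l e : ℕ} (he : e ≠ 2 * s) :
    Nat.card {p : E × F // radCard s l p = 2 ^ e} = radCount E F s l e := by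
  refine Nat.card_congr (Equiv.subtypeEquivRight fun p => ⟨fun h => ⟨?_, h⟩, fun h => h.2⟩)
  rintro rfl
  rw [radCard_zero hF] at h
  exact he (Nat.pow_right_injective le_rfl h).symm

omit [Fintype E] [Algebra (ZMod 2) E] in
include hF in
theorem natCard_radCard_eq_top {l : ℕ}
    (hr : ∀ p : E × F, p ≠ 0 → radCard s l p ≠ 2 ^ (2 * s)) :
    Nat.card {p : E × F // radCard s l p = 2 ^ (2 * s)} = 1 := by
  rw [Nat.card_eq_one_iff_unique]
  refine ⟨⟨fun p q => Subtype.ext ?_⟩, ⟨⟨0, radCard_zero hF l⟩⟩⟩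
  rw [not_imp_not.1 (hr p) p.2, not_imp_not.1 (hr q) q.2]

include hE hF

omit [Algebra (ZMod 2) E] in
omit [Fintype E] hE in
theorem radCard_ne_of_ne_zero {l : ℕ} (hl : 1 ≤ l) (hls : l < 2 * s) (hne : l ≠ s) (p : E × F)
    (hp : p ≠ 0) : radCard s l p ≠ 2 ^ (2 * s) := by
  obtain ⟨k, hk, h⟩ := exists_card_ker_kasamiPolar hF l (a := p.1) (b := p.2)
    (fun h => hp (Prod.ext h.1 h.2))
  have hlt := gcd_two_mul_add_lt hl hls hne
  rw [radCard, h]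
  intro h1
  have h2 := Nat.pow_right_injective le_rfl h1
  nlinarith

/-- The number of codewords of weight `2 ^ (2 s - 1) ± 2 ^ (s + d j - 1)`. -/
theorem weightCount_eq_radCount {l d j i : ℕ} (hs : 0 < s) (hdj : d * j < s)
    (hr : ∀ p : E × F, p ≠ 0 → radCard s l p ≠ 2 ^ (2 * s))
    (hi : i = 2 ^ (2 * s - 1) - 2 ^ (s + d * j - 1) ∨
      i = 2 ^ (2 * s - 1) + 2 ^ (s + d * j - 1)) :
    (weightCount (generalizedKasamiCode E F s l) i : ℚ) =
      radCount E F s l (2 * d * j) * 2 ^ (2 * s) / 2 ^ (2 * d * j) := by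
  have h := weight_sq (by lia) (by lia) hi
  have h1 := weightCount_mul hE hF hr (i := i) (r := 2 ^ (2 * d * j)) (by positivity) (by
    rw [h]; push_cast; rw [← pow_add]; congr 1; ring)
  rw [natCard_radCard_eq hF (by nlinarith)] at h1
  rw [eq_div_iff (by positivity)]
  exact_mod_cast h1

theorem weightCount_eq_one {l i : ℕ}
    (hr : ∀ p : E × F, p ≠ 0 → radCard s l p ≠ 2 ^ (2 * s)) (hi : i = 0 ∨ i = 2 ^ (2 * s)) :
    weightCount (generalizedKasamiCode E F s l) i = 1 := by
  have h1 := weightCount_mul hE hF hr (i := i) (r := 2 ^ (2 * s)) (by positivity) (by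
    rcases hi with rfl | rfl <;> push_cast <;> ring)
  rw [natCard_radCard_eq_top hF hr] at h1
  exact mul_right_cancel₀ (by positivity) h1

theorem weight_of_weightCount_ne_zero {l d K i : ℕ} (hs : 0 < s) (hK : d * K < s)
    (hr : ∀ p : E × F, p ≠ 0 → radCard s l p ≠ 2 ^ (2 * s))
    (hrad : ∀ p : E × F, p ≠ 0 → ∃ k ≤ K, radCard s l p = 2 ^ (2 * d * k))
    (hi : weightCount (generalizedKasamiCode E F s l) i ≠ 0) :
    i = 0 ∨ i = 2 ^ (2 * s) ∨ i = 2 ^ (2 * s - 1) ∨ ∃ j ≤ K,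
      (i = 2 ^ (2 * s - 1) - 2 ^ (s + d * j - 1) ∨ i = 2 ^ (2 * s - 1) + 2 ^ (s + d * j - 1)) := by
  have h2 : 2 * 2 ^ (2 * s - 1) = 2 ^ (2 * s) := mul_pow_sub_one (by lia) 2
  by_cases hmid : 2 * i = 2 ^ (2 * s)
  · right; right; left; lia
  obtain ⟨p, hp⟩ := exists_radCard_of_weightCount_ne_zero hE hF hr hi hmid
  by_cases hp0 : p = 0
  · rw [hp0, radCard_zero hF, Nat.cast_pow, Nat.cast_ofNat, ← pow_add, ← two_mul] at hp
    rcases eq_weight_of_sq (by lia) le_rfl hp with h | h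
    · left; lia
    · right; left; lia
  · obtain ⟨k, hk, h⟩ := hrad p hp0
    have hk' : d * k < s := (Nat.mul_le_mul_left d hk).trans_lt hK
    refine Or.inr (Or.inr (Or.inr ⟨k, hk, eq_weight_of_sq (by lia) (by lia) ?_⟩))
    rw [hp, h]
    push_cast
    rw [← pow_add]
    congr 1
    ring

omit [Algebra (ZMod 2) E] in
theorem sum_radCount {l d K : ℕ} (hd : 0 < d)
    (hrad : ∀ p : E × F, p ≠ 0 → ∃ k ≤ K, radCard s l p = 2 ^ (2 * d * k)) :
    1 + ∑ j ∈ Finset.range (K + 1), (radCount E F s l (2 * d * j) : ℚ) = 2 ^ (3 * s) := by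
  have h := sum_eq_of_radCard hd hrad (fun _ => 1) (fun _ => 1) (fun _ _ _ _ => rfl)
  simp only [mul_one] at h
  rw [← h]
  simp [hE, hF]
  ring

theorem sum_radCount_mul_pow {l d K : ℕ} (hd : 0 < d)
    (hrad : ∀ p : E × F, p ≠ 0 → ∃ k ≤ K, radCard s l p = 2 ^ (2 * d * k)) :
    2 ^ (2 * s) + ∑ j ∈ Finset.range (K + 1), (radCount E F s l (2 * d * j) : ℚ) * 2 ^ (2 * d * j) =
      2 ^ (3 * s) + (2 ^ (2 * s) - 1) * 2 ^ (s + s.gcd l) := by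
  have h := sum_eq_of_radCard hd hrad (fun p => (radCard s l p : ℚ)) (fun j => 2 ^ (2 * d * j))
    (fun p _ j hj => by rw [hj]; push_cast; rfl)
  rw [radCard_zero hF] at h
  have h1 := sum_natCard_ker_kasamiPolar hE hF l
  have h2 : ((2 ^ (2 * s) - 1 : ℕ) : ℚ) = 2 ^ (2 * s) - 1 := by
    rw [Nat.cast_sub Nat.one_le_two_pow]; push_cast; rfl
  have h3 : ∑ p : E × F, (radCard s l p : ℚ) =
      2 ^ (3 * s) + (2 ^ (2 * s) - 1) * 2 ^ (s + s.gcd l) := by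
    rw [← h2]; exact_mod_cast h1
  rw [← h3, h]
  push_cast; rfl

theorem weightCount_middle_eq {l d K i : ℕ} (hd : 0 < d) (hs : 0 < s)
    (hr : ∀ p : E × F, p ≠ 0 → radCard s l p ≠ 2 ^ (2 * s))
    (hrad : ∀ p : E × F, p ≠ 0 → ∃ k ≤ K, radCard s l p = 2 ^ (2 * d * k))
    (hi : i = 2 ^ (2 * s - 1)) :
    (weightCount (generalizedKasamiCode E F s l) i : ℚ) =
      2 * (2 ^ (2 * s) - 1 + ∑ j ∈ Finset.range (K + 1), (radCount E F s l (2 * d * j) : ℚ) *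
        (2 ^ (2 * s) - 2 ^ (2 * s) / 2 ^ (2 * d * j))) := by
  rw [weightCount_middle hE hF hr (i := i) (by rw [hi]; exact mul_pow_sub_one (by lia) 2),
    sum_eq_of_radCard hd hrad _ (fun j => 2 ^ (2 * s) - 2 ^ (2 * s) / 2 ^ (2 * d * j))
    (fun p _ j hj => by rw [hj]; push_cast; rfl), radCard_zero hF]
  push_cast
  rw [div_self (by positivity)]

theorem sum_radCount_mul_sign {l d K n k : ℕ} (hd : 0 < d) (hn : Odd n) (hk : Odd k)
    (hs : s = d * n) (hl : l = d * k)
    (hrad : ∀ p : E × F, p ≠ 0 → ∃ k ≤ K, radCard s l p = 2 ^ (2 * d * k)) :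
    2 ^ (2 * s) + ∑ j ∈ Finset.range (K + 1), (radCount E F s l (2 * d * j) : ℚ) *
      (-((-1) ^ j * 2 ^ (s + d * j))) = 2 ^ (3 * s) := by
  have h := sum_eq_of_radCard hd hrad (fun p => (expSum (kasamiForm l p.1 p.2) : ℚ))
    (fun j => -((-1) ^ j * 2 ^ (s + d * j))) (fun p _ j hj => by
      rw [expSum_kasamiForm_eq hE hF hd hn hk hs hl p.1 p.2 hj]; push_cast; rfl)
  have h0 : expSum (kasamiForm l (0 : E) (0 : F)) = 2 ^ (2 * s) := by
    simp [expSum, kasamiForm, hF]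
  have h1 := sum_expSum_kasamiForm (E := E) (F := F) hE hF l
  rw [Prod.fst_zero, Prod.snd_zero, h0, ← Int.cast_sum, h1] at h
  push_cast at h
  exact h.symm

end Distribution

/-! ### Solving the linear systems and matching the tables. -/

section Tables

variable {E F : Type*} [Field E] [Field F] [Fintype E] [Fintype F]
    [Algebra (ZMod 2) E] [Algebra (ZMod 2) F] [Algebra E F]
    {s : ℕ} (hE : Fintype.card E = 2 ^ s) (hF : Fintype.card F = 2 ^ (2 * s))

include hE hF

theorem radCount_eq_of_le_one {l d t : ℕ} (hd : 0 < d) (hst : s = d + t) (hgcd : s.gcd l = d)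
    (hrad : ∀ p : E × F, p ≠ 0 → ∃ k ≤ 1, radCard s l p = 2 ^ (2 * d * k)) :
    (radCount E F s l (2 * d * 1) : ℚ) =
        (((2 ^ d * 2 ^ t) ^ 2 - 1) * (2 ^ d * 2 ^ t * 2 ^ d - 1)) / ((2 ^ d) ^ 2 - 1) ∧
      (radCount E F s l (2 * d * 0) : ℚ) = (2 ^ d * 2 ^ t) ^ 3 - 1 -
        (((2 ^ d * 2 ^ t) ^ 2 - 1) * (2 ^ d * 2 ^ t * 2 ^ d - 1)) / ((2 ^ d) ^ 2 - 1) := by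
  have h1 := sum_radCount hE hF hd hrad
  have h2 := sum_radCount_mul_pow hE hF hd hrad
  rw [hgcd] at h2
  simp only [Finset.sum_range_succ, Finset.sum_range_zero, zero_add] at h1 h2
  have hX3 : (2 : ℚ) ^ (3 * s) = (2 ^ d * 2 ^ t) ^ 3 := by rw [hst]; ring
  have hX2 : (2 : ℚ) ^ (2 * s) = (2 ^ d * 2 ^ t) ^ 2 := by rw [hst]; ring
  have hX1 : (2 : ℚ) ^ (s + d) = 2 ^ d * 2 ^ t * 2 ^ d := by rw [hst]; ring
  have hD2 : (2 : ℚ) ^ (2 * d * 1) = (2 ^ d) ^ 2 := by ring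
  have hD0 : (2 : ℚ) ^ (2 * d * 0) = 1 := by simp
  rw [hX3, hX2, hX1, hD2, hD0] at h2
  rw [hX3] at h1
  have hD : (2 : ℚ) ≤ 2 ^ d := by
    simpa using pow_le_pow_right₀ (one_le_two (α := ℚ)) (Nat.succ_le_of_lt hd)
  generalize (radCount E F s l (2 * d * 1) : ℚ) = N at *
  generalize (radCount E F s l (2 * d * 0) : ℚ) = M at *
  generalize (2 : ℚ) ^ d = D at *
  generalize (2 : ℚ) ^ t = Z at *
  have hD1 : D ^ 2 - 1 ≠ 0 := by nlinarith
  have hN : N = (((D * Z) ^ 2 - 1) * (D * Z * D - 1)) / (D ^ 2 - 1) := by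
    rw [eq_div_iff hD1]
    -- The trivial radicals have weight one in both equations, so the difference eliminates `M`.
    linear_combination h2 - h1
  refine ⟨hN, ?_⟩
  rw [← hN]
  linear_combination h1

theorem weightCount_eq_weightTableEq {l d : ℕ} (hd : 0 < d) (hds : d < s) (hgcd : s.gcd l = d)
    (hr : ∀ p : E × F, p ≠ 0 → radCard s l p ≠ 2 ^ (2 * s))
    (hrad : ∀ p : E × F, p ≠ 0 → ∃ k ≤ 1, radCard s l p = 2 ^ (2 * d * k)) (i : ℕ) :
    (weightCount (generalizedKasamiCode E F s l) i : ℚ) = weightTableEq s d i := by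
  obtain ⟨t, hst⟩ : ∃ t, s = d + t := ⟨s - d, by lia⟩
  obtain ⟨hN1, hN0⟩ := radCount_eq_of_le_one hE hF hd hst hgcd hrad
  have hD : (2 : ℚ) ≤ 2 ^ d := by
    simpa using pow_le_pow_right₀ (one_le_two (α := ℚ)) (Nat.succ_le_of_lt hd)
  have hZ : (0 : ℚ) < 2 ^ t := by positivity
  have hD0 : (2 : ℚ) ^ d ≠ 0 := by positivity
  have hD1 : ((2 : ℚ) ^ d) ^ 2 - 1 ≠ 0 := by nlinarith
  have e1 : (2 : ℚ) ^ (2 * s) = (2 ^ d * 2 ^ t) ^ 2 := by rw [hst]; ring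
  have e2 : (2 : ℚ) ^ s = 2 ^ d * 2 ^ t := by rw [hst]; ring
  have e3 : (2 : ℚ) ^ (2 * (s + d)) = (2 ^ d * 2 ^ t * 2 ^ d) ^ 2 := by rw [hst]; ring
  have e4 : (2 : ℚ) ^ (2 * s + d) = (2 ^ d * 2 ^ t) ^ 2 * 2 ^ d := by rw [hst]; ring
  have e5 : (2 : ℚ) ^ (s + 2 * d) = 2 ^ d * 2 ^ t * (2 ^ d) ^ 2 := by rw [hst]; ring
  have e6 : (2 : ℚ) ^ (s + d) = 2 ^ d * 2 ^ t * 2 ^ d := by rw [hst]; ring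
  have e7 : (2 : ℚ) ^ (2 * d) = (2 ^ d) ^ 2 := by ring
  have e8 : (2 : ℚ) ^ (2 * (s - d)) = (2 ^ t) ^ 2 := by
    rw [hst, Nat.add_sub_cancel_left]; ring
  have e9 : (2 : ℚ) ^ (3 * s - d) = (2 ^ d) ^ 2 * (2 ^ t) ^ 3 := by
    rw [hst, show 3 * (d + t) - d = 2 * d + 3 * t by lia]; ring
  have e10 : (2 : ℚ) ^ (2 * d * 1) = (2 ^ d) ^ 2 := by ring
  have e11 : (2 : ℚ) ^ (2 * d * 0) = 1 := by simp
  unfold weightTableEq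
  split_ifs with h0 h1 h2 h3 h4
  · exact_mod_cast weightCount_eq_one hE hF hr (Or.inl h0)
  · rw [weightCount_eq_radCount hE hF (d := d) (j := 0) (by lia) (by lia) hr (by simpa using h1),
      hN0,
      e1, e2, e3, e4, e5, e6, e7, e11]
    generalize (2 : ℚ) ^ d = D at *
    field_simp
    ring
  · rw [weightCount_eq_radCount hE hF (d := d) (j := 1) (by lia) (by lia) hr (by simpa using h2),
      hN1,
      e1, e6, e7, e8, e10]
    generalize (2 : ℚ) ^ d = D at *
    field_simp
  · rw [weightCount_middle_eq hE hF hd (by lia) hr hrad h3, Finset.sum_range_succ,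
      Finset.sum_range_one, hN0, hN1, e1, e8, e9, e10, e11]
    generalize (2 : ℚ) ^ d = D at *
    field_simp
    ring
  · exact_mod_cast weightCount_eq_one hE hF hr (Or.inr h4)
  · rw [Nat.cast_eq_zero]
    by_contra hne
    rcases weight_of_weightCount_ne_zero hE hF (by lia) (by lia) hr hrad hne with
      h | h | h | ⟨j, hj, h⟩
    · exact h0 h
    · exact h4 h
    · exact h3 h
    · interval_cases j
      · exact h1 (by simpa using h)
      · exact h2 (by simpa using h)

theorem radCount_eq_of_le_two {l d n k t : ℕ} (hd : 0 < d) (hn : Odd n) (hk : Odd k)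
    (hs : s = d * n) (hl : l = d * k) (hst : s = 3 * d + t) (hgcd : s.gcd l = d)
    (hrad : ∀ p : E × F, p ≠ 0 → ∃ k ≤ 2, radCard s l p = 2 ^ (2 * d * k)) :
    ∀ D Z : ℚ, D = 2 ^ d → Z = 2 ^ t →
      (radCount E F s l (2 * d * 2) : ℚ) =
        ((D ^ 3 * Z) ^ 2 - 1) * (D ^ 2 * Z - 1) / ((D ^ 2 - 1) * (D + 1)) ∧
      (radCount E F s l (2 * d * 1) : ℚ) =
        ((D ^ 3 * Z) ^ 2 - 1) * (D ^ 3 * Z + D ^ 2 * Z + D * Z + 1) * D / (D + 1) ^ 2 ∧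
      (radCount E F s l (2 * d * 0) : ℚ) = (D ^ 3 * Z) ^ 3 - 1 -
        ((D ^ 3 * Z) ^ 2 - 1) * (D ^ 3 * Z + D ^ 2 * Z + D * Z + 1) * D / (D + 1) ^ 2 -
        ((D ^ 3 * Z) ^ 2 - 1) * (D ^ 2 * Z - 1) / ((D ^ 2 - 1) * (D + 1)) := by
  have h1 := sum_radCount hE hF hd hrad
  have h2 := sum_radCount_mul_pow hE hF hd hrad
  have h3 := sum_radCount_mul_sign hE hF hd hn hk hs hl hrad
  intro D Z hDd hZt
  rw [hgcd] at h2
  simp only [Finset.sum_range_succ, Finset.sum_range_zero, zero_add] at h1 h2 h3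
  have hX3 : (2 : ℚ) ^ (3 * s) = (D ^ 3 * Z) ^ 3 := by rw [hst, hDd, hZt]; ring
  have hX2 : (2 : ℚ) ^ (2 * s) = (D ^ 3 * Z) ^ 2 := by rw [hst, hDd, hZt]; ring
  have hX1 : (2 : ℚ) ^ (s + d) = D ^ 3 * Z * D := by rw [hst, hDd, hZt]; ring
  have hX10 : (2 : ℚ) ^ (s + d * 0) = D ^ 3 * Z := by rw [hst, hDd, hZt]; ring
  have hX11 : (2 : ℚ) ^ (s + d * 1) = D ^ 3 * Z * D := by rw [hst, hDd, hZt]; ring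
  have hX12 : (2 : ℚ) ^ (s + d * 2) = D ^ 3 * Z * D ^ 2 := by rw [hst, hDd, hZt]; ring
  have hD4 : (2 : ℚ) ^ (2 * d * 2) = D ^ 4 := by rw [hDd]; ring
  have hD2 : (2 : ℚ) ^ (2 * d * 1) = D ^ 2 := by rw [hDd]; ring
  have hD0 : (2 : ℚ) ^ (2 * d * 0) = 1 := by simp
  rw [hX3] at h1
  rw [hX3, hX2, hX1, hD4, hD2, hD0] at h2
  rw [hX3, hX2, hX10, hX11, hX12] at h3
  have hD : 2 ≤ D := by
    rw [hDd]
    simpa using pow_le_pow_right₀ (one_le_two (α := ℚ)) (Nat.succ_le_of_lt hd)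
  have hZ : 0 < Z := by rw [hZt]; positivity
  generalize (radCount E F s l (2 * d * 2) : ℚ) = A at *
  generalize (radCount E F s l (2 * d * 1) : ℚ) = B at *
  generalize (radCount E F s l (2 * d * 0) : ℚ) = C at *
  clear hDd hZt hX3 hX2 hX1 hX10 hX11 hX12 hD4 hD2 hD0
  have hD0 : D ≠ 0 := by positivity
  have hDp : D + 1 ≠ 0 := by positivity
  have hD1 : D ^ 2 - 1 ≠ 0 := by nlinarith
  have hX : D ^ 3 * Z ≠ 0 := by positivity
  -- The signed equation divided by `-2 ^ s`.
  have h4 : C - B * D + A * D ^ 2 = D ^ 3 * Z - (D ^ 3 * Z) ^ 2 := by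
    apply mul_left_cancel₀ hX
    linear_combination -h3
  have hA : A = ((D ^ 3 * Z) ^ 2 - 1) * (D ^ 2 * Z - 1) / ((D ^ 2 - 1) * (D + 1)) := by
    rw [eq_div_iff (mul_ne_zero hD1 hDp)]
    apply mul_left_cancel₀ hD0
    -- This eliminates `C` and `B`, leaving `A` with coefficient `D (D + 1) (D ^ 2 - 1)`; hence the
    -- preceding multiplication by `D`.
    linear_combination h2 - h1 - (D - 1) * (h1 - h4)
  have hB : B = ((D ^ 3 * Z) ^ 2 - 1) * (D ^ 3 * Z + D ^ 2 * Z + D * Z + 1) * D / (D + 1) ^ 2 := by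
    have h5 : B * (D + 1) = (D ^ 3 * Z + 1) * ((D ^ 3 * Z) ^ 2 - 1) + A * (D ^ 2 - 1) := by
      linear_combination h1 - h4
    rw [hA] at h5
    rw [eq_div_iff (pow_ne_zero 2 hDp), sq, ← mul_assoc, h5]
    field_simp
    ring
  refine ⟨hA, hB, ?_⟩
  rw [← hA, ← hB]
  linear_combination h1

theorem weightCount_eq_weightTableTwo {l d n k : ℕ} (hd : 0 < d) (hn : Odd n) (hk : Odd k)
    (hs : s = d * n) (hl : l = d * k) (hds : 3 * d ≤ s) (hgcd : s.gcd l = d)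
    (hr : ∀ p : E × F, p ≠ 0 → radCard s l p ≠ 2 ^ (2 * s))
    (hrad : ∀ p : E × F, p ≠ 0 → ∃ k ≤ 2, radCard s l p = 2 ^ (2 * d * k)) (i : ℕ) :
    (weightCount (generalizedKasamiCode E F s l) i : ℚ) = weightTableTwo s d i := by
  obtain ⟨t, hst⟩ : ∃ t, s = 3 * d + t := ⟨s - 3 * d, by lia⟩
  obtain ⟨D, hDd⟩ : ∃ D : ℚ, D = 2 ^ d := ⟨_, rfl⟩
  obtain ⟨Z, hZt⟩ : ∃ Z : ℚ, Z = 2 ^ t := ⟨_, rfl⟩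
  obtain ⟨hN2, hN1, hN0⟩ := radCount_eq_of_le_two hE hF hd hn hk hs hl hst hgcd hrad D Z hDd hZt
  have hD : 2 ≤ D := by
    rw [hDd]
    simpa using pow_le_pow_right₀ (one_le_two (α := ℚ)) (Nat.succ_le_of_lt hd)
  have hZ : 0 < Z := by rw [hZt]; positivity
  have hD0 : D ≠ 0 := by positivity
  have hDp : D + 1 ≠ 0 := by positivity
  have hD1 : D ^ 2 - 1 ≠ 0 := by nlinarith
  -- With `s = 3 d + t`, every exponent of the table is a combination of `d` and `t` with natural
  -- coefficients, so no subtraction is truncated.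
  have e (u a b : ℕ) (h : u = a * d + b * t) : (2 : ℚ) ^ u = D ^ a * Z ^ b := by
    rw [h, hDd, hZt]; ring
  unfold weightTableTwo
  split_ifs with h0 h1 h2 h3 h4 h5
  · exact_mod_cast weightCount_eq_one hE hF hr (Or.inl h0)
  · rw [weightCount_eq_radCount hE hF (d := d) (j := 0) (by lia) (by lia) hr (by simpa using h1),
      hN0,
      e (2 * s) 6 2 (by lia), e (2 * d * 0) 0 0 (by lia), e (2 * s + 3 * d) 9 2 (by lia),
      e s 3 1 (by lia), e (2 * (s - d)) 4 2 (by lia), e (2 * s - 3 * d) 3 2 (by lia),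
      e (s - d) 2 1 (by lia), e (2 * d) 2 0 (by lia), ← hDd]
    field_simp
    ring
  · rw [weightCount_eq_radCount hE hF (d := d) (j := 1) (by lia) (by lia) hr (by simpa using h2),
      hN1,
      e (2 * s) 6 2 (by lia), e (2 * d * 1) 2 0 (by lia), e (2 * s - d) 5 2 (by lia),
      e s 3 1 (by lia), e (s - d) 2 1 (by lia), e (s - 2 * d) 1 1 (by lia), ← hDd]
    field_simp
  · rw [weightCount_middle_eq hE hF hd (by lia) hr hrad h3, Finset.sum_range_succ,
      Finset.sum_range_succ, Finset.sum_range_one, hN0, hN1, hN2, pow_succ 2 (2 * s - 2 * d),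
      e (2 * s) 6 2 (by lia), e (2 * d * 0) 0 0 (by lia), e (2 * d * 1) 2 0 (by lia),
      e (2 * d * 2) 4 0 (by lia), e (3 * s - d) 8 3 (by lia), e (3 * s - 2 * d) 7 3 (by lia),
      e (3 * s - 3 * d) 6 3 (by lia), e (3 * s - 4 * d) 5 3 (by lia),
      e (3 * s - 5 * d) 4 3 (by lia), e (2 * s - d) 5 2 (by lia), e (2 * s - 2 * d) 4 2 (by lia),
      e (2 * s - 3 * d) 3 2 (by lia), e (2 * s - 4 * d) 2 2 (by lia)]
    field_simp
    ring
  · rw [weightCount_eq_radCount hE hF (d := d) (j := 2) (by lia) (by lia) hr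
        (by simpa [mul_comm] using h4), hN2,
      e (2 * s) 6 2 (by lia), e (2 * d * 2) 4 0 (by lia), e (2 * s - 4 * d) 2 2 (by lia),
      e (s - d) 2 1 (by lia), e (2 * d) 2 0 (by lia), ← hDd]
    field_simp
  · exact_mod_cast weightCount_eq_one hE hF hr (Or.inr h5)
  · rw [Nat.cast_eq_zero]
    by_contra hne
    rcases weight_of_weightCount_ne_zero hE hF (by lia) (by lia) hr hrad hne with
      h | h | h | ⟨j, hj, h⟩
    · exact h0 h
    · exact h5 h
    · exact h3 h
    · interval_cases j
      · exact h1 (by simpa using h)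
      · exact h2 (by simpa using h)
      · exact h4 (by simpa [mul_comm] using h)

end Tables

/-! ### Which weights occur, and the possible radical sizes in each case. -/

section Support

variable {E F : Type*} [Field E] [Field F] [Fintype E] [Fintype F]
    [Algebra (ZMod 2) E] [Algebra (ZMod 2) F] [Algebra E F]
    {s : ℕ} (hE : Fintype.card E = 2 ^ s) (hF : Fintype.card F = 2 ^ (2 * s))

include hE hF

theorem weightCount_ne_zero_iff {l d K : ℕ} (hd : 0 < d) (hs : 0 < s) (hK : d * K < s)
    (hr : ∀ p : E × F, p ≠ 0 → radCard s l p ≠ 2 ^ (2 * s))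
    (hrad : ∀ p : E × F, p ≠ 0 → ∃ k ≤ K, radCard s l p = 2 ^ (2 * d * k))
    (hN : ∀ j ≤ K, (radCount E F s l (2 * d * j) : ℚ) ≠ 0) (i : ℕ) :
    weightCount (generalizedKasamiCode E F s l) i ≠ 0 ↔
      i = 0 ∨ i = 2 ^ (2 * s) ∨ i = 2 ^ (2 * s - 1) ∨ ∃ j ≤ K,
      (i = 2 ^ (2 * s - 1) - 2 ^ (s + d * j - 1) ∨ i = 2 ^ (2 * s - 1) + 2 ^ (s + d * j - 1)) := by
  refine ⟨weight_of_weightCount_ne_zero hE hF hs hK hr hrad, ?_⟩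
  rintro (h | h | h | ⟨j, hj, h⟩)
  · rw [weightCount_eq_one hE hF hr (Or.inl h)]
    exact one_ne_zero
  · rw [weightCount_eq_one hE hF hr (Or.inr h)]
    exact one_ne_zero
  · rw [← Nat.cast_ne_zero (R := ℚ), weightCount_middle_eq hE hF hd hs hr hrad h]
    -- The pair `(0, 0)` with `c ≠ 0` already gives words of the middle weight.
    have h1 : (1 : ℚ) < 2 ^ (2 * s) := one_lt_pow₀ (by norm_num) (by lia)
    have h2 : 0 ≤ ∑ j ∈ Finset.range (K + 1), (radCount E F s l (2 * d * j) : ℚ) *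
        (2 ^ (2 * s) - 2 ^ (2 * s) / 2 ^ (2 * d * j)) := by
      refine Finset.sum_nonneg fun j _ => mul_nonneg (Nat.cast_nonneg _) (sub_nonneg.2 ?_)
      exact div_le_self (by positivity) (one_le_pow₀ (by norm_num))
    exact (by linarith : (0 : ℚ) < _).ne'
  · have hj' : d * j < s := (Nat.mul_le_mul_left d hj).trans_lt hK
    rw [← Nat.cast_ne_zero (R := ℚ), weightCount_eq_radCount hE hF hs hj' hr h]
    exact div_ne_zero (mul_ne_zero (hN j hj) (by positivity)) (by positivity)

theorem ncard_weights_eq_six {l d : ℕ} (hd : 0 < d) (hds : d < s) (hgcd : s.gcd l = d)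
    (hr : ∀ p : E × F, p ≠ 0 → radCard s l p ≠ 2 ^ (2 * s))
    (hrad : ∀ p : E × F, p ≠ 0 → ∃ k ≤ 1, radCard s l p = 2 ^ (2 * d * k)) :
    {i : ℕ | 1 ≤ i ∧ weightCount (generalizedKasamiCode E F s l) i ≠ 0}.ncard = 6 := by
  obtain ⟨t, hst⟩ : ∃ t, s = d + t := ⟨s - d, by lia⟩
  obtain ⟨hN1, hN0⟩ := radCount_eq_of_le_one hE hF hd hst hgcd hrad
  have hD : (2 : ℚ) ≤ 2 ^ d := by
    simpa using pow_le_pow_right₀ (one_le_two (α := ℚ)) (Nat.succ_le_of_lt hd)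
  have hZ : (2 : ℚ) ≤ 2 ^ t := by
    simpa using pow_le_pow_right₀ (one_le_two (α := ℚ)) (show 1 ≤ t by lia)
  have hN : ∀ j ≤ 1, (radCount E F s l (2 * d * j) : ℚ) ≠ 0 := by
    intro j hj
    generalize (2 : ℚ) ^ d = D at *
    generalize (2 : ℚ) ^ t = Z at *
    have hD1 : 0 < D ^ 2 - 1 := by nlinarith
    have hX : 4 ≤ D * Z := by nlinarith
    interval_cases j
    · rw [hN0]
      generalize D * Z = X at *
      -- Factoring out `X - 1` leaves coefficients that are visibly positive for `D ≥ 2`.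
      have h : X ^ 3 - 1 - (X ^ 2 - 1) * (X * D - 1) / (D ^ 2 - 1) =
          (X - 1) * (X ^ 2 * (D * (D - 1) - 1) + X * (D * (D - 1)) + D ^ 2) / (D ^ 2 - 1) := by
        field_simp
        ring
      rw [h]
      have h1 : 0 < X - 1 := by linarith
      have h2 : 0 < D * (D - 1) - 1 := by nlinarith
      have h3 : 0 < D * (D - 1) := by linarith
      positivity
    · rw [hN1]
      generalize D * Z = X at *
      have h1 : 0 < X ^ 2 - 1 := by nlinarith
      have h2 : 0 < X * D - 1 := by nlinarith
      positivity
  have hset : {i : ℕ | 1 ≤ i ∧ weightCount (generalizedKasamiCode E F s l) i ≠ 0} =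
      ({2 ^ (2 * s), 2 ^ (2 * s - 1), 2 ^ (2 * s - 1) - 2 ^ (s - 1), 2 ^ (2 * s - 1) + 2 ^ (s - 1),
        2 ^ (2 * s - 1) - 2 ^ (s + d - 1), 2 ^ (2 * s - 1) + 2 ^ (s + d - 1)} : Finset ℕ) := by
    ext i
    have h0 : 0 < 2 ^ (s - 1) := by positivity
    have h1 : 2 ^ (s - 1) < 2 ^ (2 * s - 1) := Nat.pow_lt_pow_right one_lt_two (by lia)
    have h2 : 2 ^ (s + d - 1) < 2 ^ (2 * s - 1) := Nat.pow_lt_pow_right one_lt_two (by lia)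
    have h3 : 0 < 2 ^ (2 * s) := by positivity
    simp only [Set.mem_ofPred_eq, weightCount_ne_zero_iff hE hF hd (by lia) (by lia) hr hrad hN,
      Nat.le_one_iff_eq_zero_or_eq_one, or_and_right, exists_or, exists_eq_left, mul_zero, mul_one,
      add_zero, Finset.coe_insert, Finset.coe_singleton, Set.mem_insert_iff, Set.mem_singleton_iff]
    lia
  have h0 : 0 < 2 ^ (s - 1) := by positivity
  have h1 : 2 ^ (s - 1) < 2 ^ (s + d - 1) := Nat.pow_lt_pow_right one_lt_two (by lia)
  have h2 : 2 ^ (s + d - 1) < 2 ^ (2 * s - 1) := Nat.pow_lt_pow_right one_lt_two (by lia)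
  have h3 : 2 * 2 ^ (2 * s - 1) = 2 ^ (2 * s) := mul_pow_sub_one (by lia) 2
  rw [hset, Set.ncard_coe_finset]
  repeat rw [Finset.card_insert_of_notMem (by
    simp only [Finset.mem_insert, Finset.mem_singleton]; lia)]
  rw [Finset.card_singleton]

theorem ncard_weights_eq_eight {l d n k : ℕ} (hd : 0 < d) (hn : Odd n) (hk : Odd k)
    (hs : s = d * n) (hl : l = d * k) (hds : 3 * d ≤ s) (hgcd : s.gcd l = d)
    (hr : ∀ p : E × F, p ≠ 0 → radCard s l p ≠ 2 ^ (2 * s))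
    (hrad : ∀ p : E × F, p ≠ 0 → ∃ k ≤ 2, radCard s l p = 2 ^ (2 * d * k)) :
    {i : ℕ | 1 ≤ i ∧ weightCount (generalizedKasamiCode E F s l) i ≠ 0}.ncard = 8 := by
  obtain ⟨t, hst⟩ : ∃ t, s = 3 * d + t := ⟨s - 3 * d, by lia⟩
  obtain ⟨D, hDd⟩ : ∃ D : ℚ, D = 2 ^ d := ⟨_, rfl⟩
  obtain ⟨Z, hZt⟩ : ∃ Z : ℚ, Z = 2 ^ t := ⟨_, rfl⟩
  obtain ⟨hN2, hN1, hN0⟩ := radCount_eq_of_le_two hE hF hd hn hk hs hl hst hgcd hrad D Z hDd hZt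
  have hD : 2 ≤ D := by
    rw [hDd]
    simpa using pow_le_pow_right₀ (one_le_two (α := ℚ)) (Nat.succ_le_of_lt hd)
  have hZ : 1 ≤ Z := by
    rw [hZt]
    exact one_le_pow₀ (by norm_num)
  have hN : ∀ j ≤ 2, (radCount E F s l (2 * d * j) : ℚ) ≠ 0 := by
    intro j hj
    have hD1 : 0 < D ^ 2 - 1 := by nlinarith
    have hX2 : 4 ≤ D ^ 2 * Z := by nlinarith
    have hX3 : 4 ≤ D ^ 3 * Z := by
      rw [show D ^ 3 * Z = D * (D ^ 2 * Z) by ring]; nlinarith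
    have hX6 : 0 < (D ^ 3 * Z) ^ 2 - 1 := by nlinarith
    interval_cases j
    · rw [hN0]
      -- As in the case of two radical sizes, with `X = D ^ 3 * Z`: the cofactor of `X - 1` is
      -- positive term by term.
      have h : (D ^ 3 * Z) ^ 3 - 1 -
          ((D ^ 3 * Z) ^ 2 - 1) * (D ^ 3 * Z + D ^ 2 * Z + D * Z + 1) * D / (D + 1) ^ 2 -
          ((D ^ 3 * Z) ^ 2 - 1) * (D ^ 2 * Z - 1) / ((D ^ 2 - 1) * (D + 1)) =
          (D ^ 3 * Z - 1) * ((D ^ 3 * Z) ^ 2 * (D * (D ^ 2 - 1) - 1) +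
            (D ^ 3 * Z) * (D ^ 2 * (D - 1)) + D ^ 3) / ((D ^ 2 - 1) * (D + 1)) := by
        field_simp
        ring
      rw [h]
      have h1 : 0 < D ^ 3 * Z - 1 := by linarith
      have h2 : 0 < D * (D ^ 2 - 1) - 1 := by nlinarith
      have h3 : 0 < D - 1 := by linarith
      positivity
    · rw [hN1]
      positivity
    · rw [hN2]
      have h1 : 0 < D ^ 2 * Z - 1 := by linarith
      positivity
  have hset : {i : ℕ | 1 ≤ i ∧ weightCount (generalizedKasamiCode E F s l) i ≠ 0} =
      ({2 ^ (2 * s), 2 ^ (2 * s - 1), 2 ^ (2 * s - 1) - 2 ^ (s - 1), 2 ^ (2 * s - 1) + 2 ^ (s - 1),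
        2 ^ (2 * s - 1) - 2 ^ (s + d - 1), 2 ^ (2 * s - 1) + 2 ^ (s + d - 1),
        2 ^ (2 * s - 1) - 2 ^ (s + d * 2 - 1), 2 ^ (2 * s - 1) + 2 ^ (s + d * 2 - 1)} :
          Finset ℕ) := by
    ext i
    have h0 : 0 < 2 ^ (s - 1) := by positivity
    have h1 : 2 ^ (s - 1) < 2 ^ (2 * s - 1) := Nat.pow_lt_pow_right one_lt_two (by lia)
    have h2 : 2 ^ (s + d - 1) < 2 ^ (2 * s - 1) := Nat.pow_lt_pow_right one_lt_two (by lia)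
    have h3 : 2 ^ (s + d * 2 - 1) < 2 ^ (2 * s - 1) := Nat.pow_lt_pow_right one_lt_two (by lia)
    have h4 : 0 < 2 ^ (2 * s) := by positivity
    have hle : ∀ j, j ≤ 2 ↔ j = 0 ∨ j = 1 ∨ j = 2 := by lia
    simp only [Set.mem_ofPred_eq, weightCount_ne_zero_iff hE hF hd (by lia) (by lia) hr hrad hN,
      hle, or_and_right, exists_or, exists_eq_left, mul_zero, mul_one,
      add_zero, Finset.coe_insert, Finset.coe_singleton, Set.mem_insert_iff, Set.mem_singleton_iff]
    lia
  have h0 : 0 < 2 ^ (s - 1) := by positivity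
  have h1 : 2 ^ (s - 1) < 2 ^ (s + d - 1) := Nat.pow_lt_pow_right one_lt_two (by lia)
  have h2 : 2 ^ (s + d - 1) < 2 ^ (s + d * 2 - 1) := Nat.pow_lt_pow_right one_lt_two (by lia)
  have h3 : 2 ^ (s + d * 2 - 1) < 2 ^ (2 * s - 1) := Nat.pow_lt_pow_right one_lt_two (by lia)
  have h4 : 2 * 2 ^ (2 * s - 1) = 2 ^ (2 * s) := mul_pow_sub_one (by lia) 2
  rw [hset, Set.ncard_coe_finset]
  repeat rw [Finset.card_insert_of_notMem (by
    simp only [Finset.mem_insert, Finset.mem_singleton]; lia)]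
  rw [Finset.card_singleton]

omit [Algebra (ZMod 2) E] in
theorem exists_radCard_of_gcd_eq {l d : ℕ} (hs : 0 < s) (hds : d ∣ s) (hdl : d ∣ l)
    (hg : (2 * s).gcd (s + l) = d) (p : E × F) (hp : p ≠ 0) :
    ∃ k ≤ 1, radCard s l p = 2 ^ (2 * d * k) := by
  obtain ⟨k, hk, h⟩ := exists_card_ker_kasamiPolar hF l (a := p.1) (b := p.2)
    (fun h => hp (Prod.ext h.1 h.2))
  rw [hg] at h
  obtain ⟨j, rfl⟩ := even_of_card_ker_kasamiPolar hE hF hds hdl hs p.1 p.2 h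
  refine ⟨j, by lia, ?_⟩
  rw [radCard, h]
  congr 1
  ring

omit [Fintype E] hE in
omit [Algebra (ZMod 2) E] in
theorem exists_radCard_of_gcd_eq_two_mul {l d : ℕ} (hg : (2 * s).gcd (s + l) = 2 * d)
    (p : E × F) (hp : p ≠ 0) : ∃ k ≤ 2, radCard s l p = 2 ^ (2 * d * k) := by
  obtain ⟨k, hk, h⟩ := exists_card_ker_kasamiPolar hF l (a := p.1) (b := p.2)
    (fun h => hp (Prod.ext h.1 h.2))
  rw [hg] at h
  exact ⟨k, hk, h⟩

end Support

/-! ### The main theorem: divisibility consequences of the two cases. -/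

theorem theorem3p3 {E F : Type*} [Field E] [Field F] [Fintype E] [Fintype F]
    [Algebra (ZMod 2) E] [Algebra (ZMod 2) F] [Algebra E F]
    (s l m d d' : ℕ) (hs : 2 ≤ s) (hm : m = 2 * s) (hl : 1 ≤ l) (hlm : l ≤ m - 1) (hls : l ≠ s)
    (hd : d = Nat.gcd s l) (hd' : d' = Nat.gcd (s + l) (2 * l))
    (hE : Fintype.card E = 2 ^ s) (hF : Fintype.card F = 2 ^ m) :
    (Module.finrank (ZMod 2) (generalizedKasamiCode E F s l) : ℚ) = 5 * (m : ℚ) / 2 + 1 ∧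
    (d' = d →
      (∀ i : ℕ, (weightCount (generalizedKasamiCode E F s l) i : ℚ) = weightTableEq s d i) ∧
      {i : ℕ | 1 ≤ i ∧ weightCount (generalizedKasamiCode E F s l) i ≠ 0}.ncard = 6) ∧
    (d' = 2 * d →
      (∀ i : ℕ, (weightCount (generalizedKasamiCode E F s l) i : ℚ) = weightTableTwo s d i) ∧
      {i : ℕ | 1 ≤ i ∧ weightCount (generalizedKasamiCode E F s l) i ≠ 0}.ncard = 8) := by
  subst hm
  have hr : ∀ p : E × F, p ≠ 0 → radCard s l p ≠ 2 ^ (2 * s) :=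
    radCard_ne_of_ne_zero hF hl (by lia) hls
  have hlt := gcd_two_mul_add_lt hl (by lia) hls
  rw [gcd_add_two_mul_comm] at hd'
  have hds : d ∣ s := hd ▸ Nat.gcd_dvd_left s l
  have hdl : d ∣ l := hd ▸ Nat.gcd_dvd_right s l
  have hd0 : 0 < d := Nat.pos_of_dvd_of_pos hds (by lia)
  refine ⟨?_, ?_, ?_⟩
  · rw [finrank_generalizedKasamiCode hE hF hr]
    push_cast
    ring
  · intro h
    rw [← hd', h] at hlt
    have hrad := exists_radCard_of_gcd_eq hE hF (by lia) hds hdl (hd'.symm.trans h)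
    exact ⟨weightCount_eq_weightTableEq hE hF hd0 hlt hd.symm hr hrad,
      ncard_weights_eq_six hE hF hd0 hlt hd.symm hr hrad⟩
  · intro h
    rw [← hd', h] at hlt
    have hrad := exists_radCard_of_gcd_eq_two_mul (E := E) hF (hd'.symm.trans h)
    have hsum : 2 * d ∣ s + l := by
      rw [← h, hd']
      exact Nat.gcd_dvd_right _ _
    obtain ⟨n, hn⟩ := hds
    obtain ⟨k, hk⟩ := hdl
    have hcop : n.gcd k = 1 := by
      rw [hn, hk, Nat.gcd_mul_left] at hd
      exact Nat.eq_of_mul_eq_mul_left hd0 (by lia)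
    -- Here `n = s / d` and `k = l / d` are coprime, and `2 d ∣ s + l` makes their sum even, so both
    -- are odd.
    have heven : Even (n + k) := by
      rw [hn, hk, ← mul_add, mul_comm 2 d] at hsum
      exact even_iff_two_dvd.2 (Nat.dvd_of_mul_dvd_mul_left hd0 hsum)
    have hodd : Odd n ∧ Odd k := by
      rcases Nat.even_or_odd n with h1 | h1
      · have h2 : 2 ∣ n.gcd k :=
          Nat.dvd_gcd h1.two_dvd ((Nat.even_add.1 heven).1 h1).two_dvd
        rw [hcop] at h2
        lia
      · exact ⟨h1, by
          rw [← Nat.not_even_iff_odd, ← Nat.even_add.1 heven, Nat.not_even_iff_odd]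
          exact h1⟩
    -- The odd number `n` is not `1`, since `2 d = d' < s`.
    have h3 : 3 * d ≤ s := by
      obtain ⟨c, hc⟩ := hodd.1
      rw [hn, hc] at hlt ⊢
      have : 1 ≤ c := by
        by_contra! h0
        obtain rfl : c = 0 := by lia
        lia
      nlinarith
    exact ⟨weightCount_eq_weightTableTwo hE hF hd0 hodd.1 hodd.2 hn hk h3 hd.symm hr hrad,
      ncard_weights_eq_eight hE hF hd0 hodd.1 hodd.2 hn hk h3 hd.symm hr hrad⟩
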